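/- All graphs are finite, undirected and without loops; multiple edges are allowed, and a graph is simple if it has no multiple edges. Let $\Delta(G)$ be the maximum degree of $G$, and let $\chi'(G)$ be its chromatic index, i.e. the least $t$ for which $G$ has a proper edge coloring with colors in $\{1,\dots,t\}$. A graph is Class 1 if $\chi'(G)=\Delta(G)$, and Class 2 if $\chi'(G)=\Delta(G)+1$. A graph $G$ is interval colorable if for some $t$ it has a proper edge coloring with colors in $\{1,\dots,t\}$ such that, at every vertex, the colors of the incident edges form a (possibly empty) interval of integers. The interval coloring thickness $\theta_{\mathrm{int}}(G)$ is the least positive integer $k$ for which there are $k$ interval colorable subgraphs of $G$ such that every edge of $G$ belongs to exactly one of them. Then: (i) for every graph $G$ with at least one edge, $\theta_{\mathrm{int}}(G)\le 2\left\lceil \frac{3\Delta(G)}{10}\right\rceil$; (ii) for every simple Class 1 graph $G$ with at least one edge, $\theta_{\mathrm{int}}(G)\le 2\left\lceil \frac{\Delta(G)}{5}\right\rceil$; (iii) for every simple Class 2 graph $G$, $\theta_{\mathrm{int}}(G)\le 2\left\lceil \frac{\Delta(G)+1}{5}\right\rceil$. -/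

import Mathlib

/-!
Undirected multigraphs are Mathlib's `Graph α β` (vertices in `α`, edges in `β`); a graph in the
sense of the theorem is one that is loopless and has finitely many vertices and edges.
-/

namespace Graph

variable {α β : Type*}

/-- The degree of a vertex of a loopless graph: the number of edges incident with it. -/
noncomputable def degree (G : Graph α β) (v : α) : ℕ := (G.incidenceSet v).ncard

/-- The maximum degree `Δ(G)` of a finite loopless graph. -/
noncomputable def maxDegree (G : Graph α β) : ℕ := sSup (G.degree '' G.vertexSet)

/-- `c` is a proper `t`-edge coloring of `G`: the edges of `G` get colors from `{1, …, t}`, and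
distinct edges with a common end get distinct colors. (Values of `c` outside the edge set of `G`
play no role.) -/
structure IsProperEdgeColoring (G : Graph α β) (t : ℕ) (c : β → ℕ) : Prop where
  mem_Icc : ∀ e ∈ G.edgeSet, c e ∈ Set.Icc 1 t
  ne_of_inc : ∀ ⦃e f v⦄, G.Inc e v → G.Inc f v → e ≠ f → c e ≠ c f

/-- `c` is an interval `t`-coloring of `G`: it is a proper `t`-edge coloring, and at every vertex
the set of colors of the incident edges is an interval of integers (the empty one at an isolated
vertex). -/
structure IsIntervalColoring (G : Graph α β) (t : ℕ) (c : β → ℕ) : Prop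
    extends G.IsProperEdgeColoring t c where
  interval : ∀ v ∈ G.vertexSet, ∃ a b : ℕ, c '' G.incidenceSet v = Set.Icc a b

/-- `G` has an interval `t`-coloring for some `t`. -/
def IntervalColorable (G : Graph α β) : Prop := ∃ t c, G.IsIntervalColoring t c

/-- The chromatic index `χ'(G)`: the least `t` such that `G` has a proper `t`-edge coloring
(`⊤` if there is none, which does not happen for finite graphs). -/
noncomputable def chromaticIndex (G : Graph α β) : ℕ∞ :=
  ⨅ t ∈ {t : ℕ | ∃ c, G.IsProperEdgeColoring t c}, (t : ℕ∞)

/-- `G` has a decomposition into `k` interval colorable subgraphs: there is a list of `k` interval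
colorable subgraphs of `G` such that every edge of `G` lies in exactly one of them. -/
def HasIntervalDecomposition (G : Graph α β) (k : ℕ) : Prop :=
  ∃ H : Fin k → Graph α β, (∀ i, H i ≤ G) ∧ (∀ i, (H i).IntervalColorable) ∧
    ∀ e ∈ G.edgeSet, ∃! i, e ∈ (H i).edgeSet

/-- The interval coloring thickness `θ_int(G)`: the least positive integer `k` such that `G` has a
decomposition into `k` interval colorable subgraphs (`⊤` if there is none, which does not happen
for finite loopless graphs). -/
noncomputable def intervalThickness (G : Graph α β) : ℕ∞ :=
  ⨅ k ∈ {k : ℕ | 1 ≤ k ∧ G.HasIntervalDecomposition k}, (k : ℕ∞)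

/-- Class 1 (used for simple graphs): `χ'(G) = Δ(G)`. -/
def IsClassOne (G : Graph α β) : Prop := G.chromaticIndex = (G.maxDegree : ℕ∞)

/-- Class 2 (used for simple graphs): `χ'(G) = Δ(G) + 1`. -/
def IsClassTwo (G : Graph α β) : Prop := G.chromaticIndex = ((G.maxDegree + 1 : ℕ) : ℕ∞)

end Graph

/-! Everything rests on one fact: a graph with a proper 5-edge coloring splits into two interval
colorable subgraphs. Grouping `5 * k` colors by fives then gives `2 * k` subgraphs. The number of
colors is `⌊3Δ/2⌋` in (i), by Shannon's theorem, and the chromatic index in (ii) and (iii).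

Three colors 1, 2, 3 give an interval coloring when no edge of color 3 is in conflict: shift 1, 2 to
2, 3 and give each edge of color 3 the color 1 or 4, as its ends demand. A conflict is an edge whose
ends make opposite demands.

Given five colors, build one subgraph on 1, 2 and the other on 4, 5, and distribute color 3 between
them. An edge of color 3 in conflict for only one of the pairs can be placed with the other pair.
The obstacle is a double conflict `p = uv`. Let `u` be its end that sees 1, and `e = ux` the edge of
color 1 there. Moving `e` to the 4, 5 side, as a third color, frees `p`. This does no harm if `x`
sees 2, 4 and 5, and if the far end `y` of an edge `q = xy` of color 3 sees 2.

These properties hold in a coloring that minimizes lexicographically the number of edges of color 3,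
of conflicts, and of double conflicts (`IsDouble.sees_x_four_five`, `IsDouble.sees_x_two`,
`IsDouble.sees_y_two`). Each failure allows a recoloring of `e`, a Kempe swap, or a rotation of `p`,
`e`, `q` that improves the coloring. The swaps use enlarged Kempe chains that also run through edges
of color 3, so that they create no conflicts except on edges deliberately cut out. -/

namespace SimpleGraph

/-- In a graph of maximum degree at most two, three vertices of degree at most one do not lie in
one component. -/
theorem not_reachable_of_degree_le_one {α : Type*} (Γ : SimpleGraph α)
    (h2 : ∀ w x y z, Γ.Adj w x → Γ.Adj w y → Γ.Adj w z → x = y ∨ y = z ∨ x = z)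
    {u v w : α} (huv : u ≠ v) (huw : u ≠ w) (hvw : v ≠ w)
    (hu : ∀ x y, Γ.Adj u x → Γ.Adj u y → x = y)
    (hv : ∀ x y, Γ.Adj v x → Γ.Adj v y → x = y)
    (hw : ∀ x y, Γ.Adj w x → Γ.Adj w y → x = y)
    (h1 : Γ.Reachable u v) : ¬ Γ.Reachable u w := by
  intro h3
  obtain ⟨p, hp⟩ := (h1.symm.trans h3).exists_isPath
  have hinj : ∀ i j, i ≤ p.length → j ≤ p.length → p.getVert i = p.getVert j → i = j :=
    fun i j hi hj h => hp.getVert_injOn hi hj h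
  have hadj : ∀ i, i < p.length → Γ.Adj (p.getVert i) (p.getVert (i + 1)) :=
    fun i hi => p.adj_getVert_succ hi
  have hpos : 0 < p.length := by
    rcases Nat.eq_zero_or_pos p.length with h | h
    · exact absurd (SimpleGraph.Walk.eq_of_length_eq_zero h) hvw
    · exact h
  -- The path from `v` to `w` is a whole component: its interior vertices already have two neighbors
  -- on it, its ends one.
  have hclosed : ∀ x y, x ∈ p.support → Γ.Adj x y → y ∈ p.support := by
    intro x y hx hxy
    obtain ⟨i, rfl, hi⟩ := SimpleGraph.Walk.mem_support_iff_exists_getVert.1 hx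
    rcases Nat.eq_zero_or_pos i with rfl | hi0
    · have := hv y (p.getVert 1) (by simpa using hxy) (by simpa using hadj 0 hpos)
      rw [this]; exact p.getVert_mem_support 1
    rcases hi.eq_or_lt with rfl | hlt
    · have h := hadj (p.length - 1) (by omega)
      rw [Nat.sub_add_cancel hpos] at h
      rw [SimpleGraph.Walk.getVert_length] at hxy h
      rw [hw y _ hxy h.symm]; exact p.getVert_mem_support _
    · have h := hadj (i - 1) (by omega)
      rw [Nat.sub_add_cancel hi0] at h
      rcases h2 _ _ _ _ h.symm (hadj i hlt) hxy with h | h | h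
      · have := hinj _ _ (by omega) (by omega) h
        omega
      · rw [← h]; exact p.getVert_mem_support _
      · rw [← h]; exact p.getVert_mem_support _
  have hall : ∀ a x, Γ.Walk a x → a ∈ p.support → x ∈ p.support := by
    intro a x q
    induction q with
    | nil => exact id
    | cons h q ih => exact fun ha => ih (hclosed _ _ ha h)
  obtain ⟨q⟩ := h1.symm
  obtain ⟨i, hiu, hi⟩ := SimpleGraph.Walk.mem_support_iff_exists_getVert.1
    (hall v u q p.start_mem_support)
  rcases Nat.eq_zero_or_pos i with rfl | hi0
  · exact huv (by simpa using hiu.symm)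
  rcases hi.eq_or_lt with rfl | hlt
  · exact huw (by simpa using hiu.symm)
  -- So `u` is interior to the path and has two distinct neighbors, against `hu`.
  have h := hadj (i - 1) (by omega)
  have h' := hadj i hlt
  rw [Nat.sub_add_cancel hi0] at h
  rw [hiu] at h h'
  have := hinj _ _ (by omega) (by omega) (hu _ _ h.symm h')
  omega

end SimpleGraph

/-! ### Conflicts, recoloring and Kempe swaps -/

namespace Graph

variable {α β : Type*} (G : Graph α β)

/-- Some edge at `v` has color `i`. -/
def Sees (c : β → ℕ) (v : α) (i : ℕ) : Prop := ∃ e, G.Inc e v ∧ c e = i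

/-- Adjacent edges have distinct colors, except that color `0` stands for an uncolored edge. -/
def IsPartialColoring (c : β → ℕ) : Prop :=
  ∀ ⦃e f v⦄, G.Inc e v → G.Inc f v → c e = c f → c e ≠ 0 → e = f

/-- Exactly one of the colors `a`, `b` appears at `v`. -/
def SeesOne (c : β → ℕ) (a b : ℕ) (v : α) : Prop := ¬(G.Sees c v a ↔ G.Sees c v b)

/-- `m` is an edge of color `3`, and one of its ends sees `a` but not `b`, while the other end
sees `b` but not `a`. -/
def IsConflict (c : β → ℕ) (a b : ℕ) (m : β) : Prop :=
  c m = 3 ∧ ∃ u v, G.IsLink m u v ∧ G.Sees c u a ∧ ¬G.Sees c u b ∧ G.Sees c v b ∧ ¬G.Sees c v a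

/-- Vertices are adjacent if they are joined by an edge of color `a` or `b`, or by an edge of
color `3` that is not in `R` and whose ends each see exactly one of `a` and `b`. -/
def kempeGraph (c : β → ℕ) (a b : ℕ) (R : Set β) : SimpleGraph α where
  Adj u v := u ≠ v ∧ ∃ e, G.IsLink e u v ∧
    (c e = a ∨ c e = b ∨ (c e = 3 ∧ e ∉ R ∧ G.SeesOne c a b u ∧ G.SeesOne c a b v))
  symm := ⟨by
    rintro u v ⟨h, e, he, h'⟩
    exact ⟨h.symm, e, he.symm, by tauto⟩⟩
  loopless := ⟨by rintro u ⟨h, -⟩; exact h rfl⟩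

open Classical in
/-- Exchange the colors `a` and `b` on all edges that meet `C`. -/
noncomputable def swapOn (c : β → ℕ) (a b : ℕ) (C : Set α) (e : β) : ℕ :=
  if ∃ v ∈ C, G.Inc e v then Equiv.swap a b (c e) else c e

/-- No edge of color `a` or `b` leaves `C`. -/
def IsKempeClosed (c : β → ℕ) (a b : ℕ) (C : Set α) : Prop :=
  ∀ ⦃e u v⦄, G.IsLink e u v → (c e = a ∨ c e = b) → u ∈ C → v ∈ C

variable {G} {c : β → ℕ} {a b i j : ℕ} {C : Set α} {R : Set β} {e f m : β} {u v w x y z : α}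

theorem IsConflict.symm (h : G.IsConflict c a b m) : G.IsConflict c b a m := by
  obtain ⟨h3, u, v, hl, h1, h2, h4, h5⟩ := h
  exact ⟨h3, v, u, hl.symm, h4, h5, h1, h2⟩

theorem isConflict_comm : G.IsConflict c a b m ↔ G.IsConflict c b a m :=
  ⟨IsConflict.symm, IsConflict.symm⟩

theorem IsConflict.seesOne (h : G.IsConflict c a b m) (hm : G.Inc m v) : G.SeesOne c a b v := by
  obtain ⟨h3, x, y, hl, h1, h2, h4, h5⟩ := h
  rcases hm.eq_or_eq_of_isLink hl with rfl | rfl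
  · exact fun h => h2 (h.1 h1)
  · exact fun h => h5 (h.2 h4)

theorem IsConflict.of_sees (h : G.IsConflict c a b m) (hl : G.IsLink m u v)
    (hu : G.Sees c u a) : ¬G.Sees c u b ∧ G.Sees c v b ∧ ¬G.Sees c v a := by
  obtain ⟨h3, x, y, hl', h1, h2, h4, h5⟩ := h
  rcases hl.eq_and_eq_or_eq_and_eq hl' with ⟨rfl, rfl⟩ | ⟨rfl, rfl⟩
  · exact ⟨h2, h4, h5⟩
  · exact absurd hu h5

theorem not_isConflict_of_sees (hm : G.Inc m v) (ha : G.Sees c v a) (hb : G.Sees c v b) :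
    ¬G.IsConflict c a b m := fun h => h.seesOne hm (iff_of_true ha hb)

theorem not_isConflict_of_not_sees (hm : G.Inc m v) (ha : ¬G.Sees c v a) (hb : ¬G.Sees c v b) :
    ¬G.IsConflict c a b m := fun h => h.seesOne hm (iff_of_false ha hb)

theorem IsConflict.edge_mem (h : G.IsConflict c a b m) : m ∈ G.edgeSet := by
  obtain ⟨-, u, v, hl, -⟩ := h
  exact hl.edge_mem

/-- Whether an edge is in conflict depends only on its color and on the colors at its ends. -/
theorem IsConflict.congr {c' : β → ℕ} (h : G.IsConflict c' a b m) (h3 : c m = 3)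
    (hs : ∀ v, G.Inc m v → (G.Sees c' v a ↔ G.Sees c v a) ∧ (G.Sees c' v b ↔ G.Sees c v b)) :
    G.IsConflict c a b m := by
  obtain ⟨-, u, v, hl, h1, h2, h4, h5⟩ := h
  have hu := hs u hl.inc_left
  have hv := hs v hl.inc_right
  exact ⟨h3, u, v, hl, hu.1.1 h1, fun h => h2 (hu.2.2 h), hv.2.1 h4, fun h => h5 (hv.1.2 h)⟩

section update

variable [DecidableEq β]

theorem IsPartialColoring.update (hc : G.IsPartialColoring c)
    (h : i = 0 ∨ ∀ f v, G.Inc e v → G.Inc f v → f ≠ e → c f ≠ i) :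
    G.IsPartialColoring (Function.update c e i) := by
  intro f g v hf hg hfg h0
  by_cases hfe : f = e
  · subst hfe
    by_contra hne
    rw [Function.update_self] at hfg h0
    rw [Function.update_of_ne (Ne.symm hne)] at hfg
    rcases h with h | h
    · exact h0 h
    · exact h g v hf hg (Ne.symm hne) hfg.symm
  · rw [Function.update_of_ne hfe] at hfg h0
    by_cases hge : g = e
    · subst hge
      rw [Function.update_self] at hfg
      rcases h with h | h
      · exact absurd (hfg.trans h) h0
      · exact absurd hfg (h f v hg hf hfe)
    · rw [Function.update_of_ne hge] at hfg
      exact hc hf hg hfg h0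

theorem IsPartialColoring.update_of_not_sees (hc : G.IsPartialColoring c) (hl : G.IsLink e u v)
    (hu : ¬G.Sees c u i) (hv : ¬G.Sees c v i) : G.IsPartialColoring (Function.update c e i) := by
  refine hc.update (Or.inr fun f w hew hfw _ hfi => ?_)
  rcases hew.eq_or_eq_of_isLink hl with rfl | rfl
  · exact hu ⟨f, hfw, hfi⟩
  · exact hv ⟨f, hfw, hfi⟩

theorem IsPartialColoring.sees_update (hc : G.IsPartialColoring c) (he : G.Inc e v) (hj : j ≠ 0) :
    G.Sees (Function.update c e i) v j ↔ j = i ∨ (G.Sees c v j ∧ j ≠ c e) := by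
  constructor
  · rintro ⟨f, hf, hfj⟩
    by_cases hfe : f = e
    · subst hfe
      exact Or.inl (by rw [← hfj, Function.update_self])
    · rw [Function.update_of_ne hfe] at hfj
      exact Or.inr ⟨⟨f, hf, hfj⟩, fun h => hfe (hc hf he (hfj.trans h) (hfj ▸ hj))⟩
  · rintro (rfl | ⟨⟨f, hf, rfl⟩, h⟩)
    · exact ⟨e, he, Function.update_self ..⟩
    · refine ⟨f, hf, Function.update_of_ne ?_ ..⟩
      rintro rfl
      exact h rfl

theorem sees_update_of_not_inc (he : ¬G.Inc e v) :
    G.Sees (Function.update c e i) v j ↔ G.Sees c v j := by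
  refine exists_congr fun f => and_congr_right fun hf => ?_
  rw [Function.update_of_ne]
  rintro rfl
  exact he hf

end update

section swap

theorem swapOn_of_mem (hv : v ∈ C) (he : G.Inc e v) :
    G.swapOn c a b C e = Equiv.swap a b (c e) := if_pos ⟨v, hv, he⟩

theorem IsKempeClosed.swapOn_of_notMem (hC : G.IsKempeClosed c a b C) (hv : v ∉ C)
    (he : G.Inc e v) : G.swapOn c a b C e = c e := by
  unfold swapOn
  split_ifs with h
  · obtain ⟨w, hw, hew⟩ := h
    apply Equiv.swap_apply_of_ne_of_ne
    all_goals
      intro hce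
      rcases he.eq_or_eq_of_isLink hew.isLink_other with h | h
      · exact hv (h ▸ hw)
      · exact hv (h ▸ hC hew.isLink_other (by tauto) hw)
  · rfl

theorem swapOn_cases : G.swapOn c a b C e = c e ∨
    (c e = a ∧ G.swapOn c a b C e = b) ∨ (c e = b ∧ G.swapOn c a b C e = a) := by
  unfold swapOn
  split_ifs
  · by_cases ha : c e = a
    · simp [ha]
    · by_cases hb : c e = b
      · simp [hb]
      · exact Or.inl (Equiv.swap_apply_of_ne_of_ne ha hb)
  · exact Or.inl rfl

theorem swapOn_eq_iff (ha : i ≠ a) (hb : i ≠ b) : G.swapOn c a b C e = i ↔ c e = i := by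
  rcases swapOn_cases (G := G) (c := c) (a := a) (b := b) (C := C) (e := e) with h | h | h
  · rw [h]
  · rw [h.1, h.2]; simp [ha.symm, hb.symm]
  · rw [h.1, h.2]; simp [ha.symm, hb.symm]

theorem IsKempeClosed.isPartialColoring_swapOn (hC : G.IsKempeClosed c a b C)
    (hc : G.IsPartialColoring c) (ha : a ≠ 0) (hb : b ≠ 0) :
    G.IsPartialColoring (G.swapOn c a b C) := by
  intro e f v he hf hef h0
  have hce : c e ≠ 0 := fun h => h0 ((swapOn_eq_iff ha.symm hb.symm).2 h)
  by_cases hv : v ∈ C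
  · rw [swapOn_of_mem hv he, swapOn_of_mem hv hf] at hef
    exact hc he hf ((Equiv.swap a b).injective hef) hce
  · rw [hC.swapOn_of_notMem hv he, hC.swapOn_of_notMem hv hf] at hef
    exact hc he hf hef hce

theorem sees_swapOn_of_mem (hv : v ∈ C) :
    G.Sees (G.swapOn c a b C) v i ↔ G.Sees c v (Equiv.swap a b i) := by
  refine exists_congr fun e => and_congr_right fun he => ?_
  rw [swapOn_of_mem hv he]
  constructor
  · rintro rfl; simp
  · rintro h; rw [h]; simp

theorem sees_swapOn_of_mem_left (hv : v ∈ C) :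
    G.Sees (G.swapOn c a b C) v a ↔ G.Sees c v b := by
  rw [sees_swapOn_of_mem hv, Equiv.swap_apply_left]

theorem sees_swapOn_of_mem_right (hv : v ∈ C) :
    G.Sees (G.swapOn c a b C) v b ↔ G.Sees c v a := by
  rw [sees_swapOn_of_mem hv, Equiv.swap_apply_right]

theorem IsKempeClosed.sees_swapOn_of_notMem (hC : G.IsKempeClosed c a b C) (hv : v ∉ C) :
    G.Sees (G.swapOn c a b C) v i ↔ G.Sees c v i :=
  exists_congr fun e => and_congr_right fun he => by rw [hC.swapOn_of_notMem hv he]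

theorem sees_swapOn_of_ne (ha : i ≠ a) (hb : i ≠ b) :
    G.Sees (G.swapOn c a b C) v i ↔ G.Sees c v i :=
  exists_congr fun _ => and_congr_right fun _ => swapOn_eq_iff ha hb

/-- The component of `u` in a Kempe graph is closed. -/
theorem reachable_kempeGraph_of_isLink (he : G.IsLink e v w)
    (h : c e = a ∨ c e = b ∨ (c e = 3 ∧ e ∉ R ∧ G.SeesOne c a b v ∧ G.SeesOne c a b w))
    (hv : (G.kempeGraph c a b R).Reachable u v) : (G.kempeGraph c a b R).Reachable u w := by
  by_cases hvw : v = w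
  · exact hvw ▸ hv
  · exact hv.trans (SimpleGraph.Adj.reachable ⟨hvw, e, he, h⟩)

theorem isKempeClosed_reachable :
    G.IsKempeClosed c a b {v | (G.kempeGraph c a b R).Reachable u v} :=
  fun _ _ _ he h hv => reachable_kempeGraph_of_isLink he (by tauto) hv

/-- A swap along a component of the Kempe graph creates conflicts only on removed edges. -/
theorem IsConflict.of_swapOn (ha : a ≠ 3) (hb : b ≠ 3) (hm : m ∉ R)
    (h : G.IsConflict (G.swapOn c a b {v | (G.kempeGraph c a b R).Reachable u v}) a b m) :
    G.IsConflict c a b m := by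
  obtain ⟨h3, x, y, hl, h1, h2, h4, h5⟩ := h
  rw [swapOn_eq_iff ha.symm hb.symm] at h3
  have hC := isKempeClosed_reachable (G := G) (c := c) (a := a) (b := b) (R := R) (u := u)
  set C := {v | (G.kempeGraph c a b R).Reachable u v}
  have hone : ∀ w, SeesOne G (G.swapOn c a b C) a b w → SeesOne G c a b w := by
    intro w hw h
    apply hw
    by_cases hwC : w ∈ C
    · rw [sees_swapOn_of_mem_left hwC, sees_swapOn_of_mem_right hwC, h]
    · rw [hC.sees_swapOn_of_notMem hwC, hC.sees_swapOn_of_notMem hwC, h]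
  have hx : SeesOne G c a b x := hone x fun h => h2 (h.1 h1)
  have hy : SeesOne G c a b y := hone y fun h => h5 (h.2 h4)
  -- As `m` is an edge of the Kempe graph, both its ends are swapped or neither is. Swapping both
  -- only exchanges their roles.
  by_cases hxC : x ∈ C
  · have hyC : y ∈ C := reachable_kempeGraph_of_isLink hl (Or.inr (Or.inr ⟨h3, hm, hx, hy⟩)) hxC
    rw [sees_swapOn_of_mem_left hxC] at h1
    rw [sees_swapOn_of_mem_right hxC] at h2
    rw [sees_swapOn_of_mem_left hyC] at h5
    rw [sees_swapOn_of_mem_right hyC] at h4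
    exact ⟨h3, y, x, hl.symm, h4, h5, h1, h2⟩
  · have hyC : y ∉ C := fun hyC => hxC
      (reachable_kempeGraph_of_isLink hl.symm (Or.inr (Or.inr ⟨h3, hm, hy, hx⟩)) hyC)
    rw [hC.sees_swapOn_of_notMem hxC] at h1 h2
    rw [hC.sees_swapOn_of_notMem hyC] at h4 h5
    exact ⟨h3, x, y, hl, h1, h2, h4, h5⟩

theorem IsConflict.of_swapOn_of_ne (ha : a ≠ 3) (hb : b ≠ 3) (hia : i ≠ a) (hib : i ≠ b)
    (hja : j ≠ a) (hjb : j ≠ b) (h : G.IsConflict (G.swapOn c a b C) i j m) :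
    G.IsConflict c i j m :=
  h.congr ((swapOn_eq_iff ha.symm hb.symm).1 h.1) fun _ _ =>
    ⟨sees_swapOn_of_ne hia hib, sees_swapOn_of_ne hja hjb⟩

end swap

section kempe

/-- A vertex that sees both `a` and `b` uses no edge of color 3 here, and any other vertex has at
most one edge of color `a` or `b` and one of color 3. -/
theorem IsPartialColoring.kempeGraph_degree_le_two (hc : G.IsPartialColoring c)
    (ha : a ≠ 0) (hb : b ≠ 0) (hx : (G.kempeGraph c a b R).Adj w x)
    (hy : (G.kempeGraph c a b R).Adj w y) (hz : (G.kempeGraph c a b R).Adj w z) :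
    x = y ∨ y = z ∨ x = z := by
  obtain ⟨-, e, he, hce⟩ := hx
  obtain ⟨-, f, hf, hcf⟩ := hy
  obtain ⟨-, g, hg, hcg⟩ := hz
  have key : ∀ {e f x y}, G.IsLink e w x → G.IsLink f w y → c e = c f → c e ≠ 0 → x = y := by
    intro e f x y he hf h h0
    have := hc he.inc_left hf.inc_left h h0
    subst this
    exact he.right_unique hf
  have no : G.SeesOne c a b w → G.Sees c w a → ¬G.Sees c w b :=
    fun h h1 h2 => h (iff_of_true h1 h2)
  have se : ∀ {e x k}, G.IsLink e w x → c e = k → G.Sees c w k :=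
    fun he h => ⟨_, he.inc_left, h⟩
  have kef := key he hf
  have keg := key he hg
  have kfg := key hf hg
  rcases hce with h1 | h1 | ⟨h1, -, o, -⟩ <;> rcases hcf with h2 | h2 | ⟨h2, -, o', -⟩ <;>
    rcases hcg with h3 | h3 | ⟨h3, -, o'', -⟩ <;>
    first
    | exact Or.inl (kef (h1.trans h2.symm) (by omega))
    | exact Or.inr (Or.inl (kfg (h2.trans h3.symm) (by omega)))
    | exact Or.inr (Or.inr (keg (h1.trans h3.symm) (by omega)))
    | (exfalso; first | exact no o (se hf h2) (se hg h3) | exact no o (se hg h3) (se hf h2)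
                      | exact no o' (se he h1) (se hg h3) | exact no o' (se hg h3) (se he h1)
                      | exact no o'' (se he h1) (se hf h2) | exact no o'' (se hf h2) (se he h1))

/-- Identifies chain ends: `hab` leaves at most one edge of color `a` or `b`, and `h3` excludes the
edge of color 3. -/
theorem IsPartialColoring.kempeGraph_degree_le_one (hc : G.IsPartialColoring c)
    (ha : a ≠ 0) (hb : b ≠ 0) (hab : ¬(G.Sees c w a ∧ G.Sees c w b))
    (h3 : ∀ e v, G.IsLink e w v → c e = 3 → e ∉ R → G.SeesOne c a b w → ¬G.SeesOne c a b v)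
    (x y : α) (hx : (G.kempeGraph c a b R).Adj w x)
    (hy : (G.kempeGraph c a b R).Adj w y) : x = y := by
  obtain ⟨-, e, he, hce⟩ := hx
  obtain ⟨-, f, hf, hcf⟩ := hy
  have hce' : c e = a ∨ c e = b := by
    rcases hce with h | h | ⟨h, hR, h1, h2⟩
    · exact Or.inl h
    · exact Or.inr h
    · exact absurd h2 (h3 e x he h hR h1)
  have hcf' : c f = a ∨ c f = b := by
    rcases hcf with h | h | ⟨h, hR, h1, h2⟩
    · exact Or.inl h
    · exact Or.inr h
    · exact absurd h2 (h3 f y hf h hR h1)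
  have hef : c e = c f := by
    rcases hce' with h | h <;> rcases hcf' with h' | h'
    · rw [h, h']
    · exact absurd ⟨⟨e, he.inc_left, h⟩, ⟨f, hf.inc_left, h'⟩⟩ hab
    · exact absurd ⟨⟨f, hf.inc_left, h'⟩, ⟨e, he.inc_left, h⟩⟩ hab
    · rw [h, h']
  have := hc he.inc_left hf.inc_left hef (by rcases hce' with h | h <;> omega)
  subst this
  exact he.right_unique hf

end kempe

end Graph

/-! ### Shannon's theorem -/

namespace Graph

variable {α β : Type*} {G : Graph α β}

open Classical in
/-- The colors from `{1, …, k}` that are missing at `v`. -/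
noncomputable def missingColors (G : Graph α β) (c : β → ℕ) (k : ℕ) (v : α) : Finset ℕ :=
  (Finset.Icc 1 k).filter fun i => ¬G.Sees c v i

variable {c : β → ℕ} {k i a : ℕ} {e f : β} {u v w : α}

theorem mem_missingColors :
    i ∈ G.missingColors c k v ↔ (1 ≤ i ∧ i ≤ k) ∧ ¬G.Sees c v i := by
  simp [missingColors]

theorem le_card_missingColors_add (s : Set β)
    (hs : ∀ e, G.Inc e v → c e ≠ 0 → e ∈ s) (hsf : s.Finite) :
    k ≤ (G.missingColors c k v).card + s.ncard := by
  classical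
  have h1 := Finset.card_filter_add_card_filter_not (s := Finset.Icc 1 k) (fun i => G.Sees c v i)
  rw [Nat.card_Icc] at h1
  have h2 : ((Finset.Icc 1 k).filter fun i => G.Sees c v i).card ≤ s.ncard := by
    rw [← Set.ncard_coe_finset]
    refine (Set.ncard_le_ncard ?_ (hsf.image c)).trans (Set.ncard_image_le hsf)
    intro i hi
    simp only [Finset.coe_filter, Finset.mem_Icc, Set.mem_ofPred_eq] at hi
    obtain ⟨⟨h1, -⟩, e, he, rfl⟩ := hi
    exact ⟨e, hs e he (by omega), rfl⟩
  unfold missingColors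
  omega

theorem le_card_missingColors_add_degree (hE : G.edgeSet.Finite) :
    k ≤ (G.missingColors c k v).card + G.degree v :=
  le_card_missingColors_add _ (fun _ he _ => he) (hE.subset (G.incidenceSet_subset_edgeSet v))

theorem lt_card_missingColors_add_degree (hE : G.edgeSet.Finite) (he : G.Inc e v) (h0 : c e = 0) :
    k + 1 ≤ (G.missingColors c k v).card + G.degree v := by
  have hf := hE.subset (G.incidenceSet_subset_edgeSet v)
  have h := le_card_missingColors_add (c := c) (k := k) (v := v) (G.incidenceSet v \ {e})
    (fun f hf h => ⟨hf, by rintro rfl; exact h h0⟩) (hf.subset Set.sdiff_subset)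
  have h2 : (G.incidenceSet v \ {e}).ncard + 1 = G.degree v :=
    Set.ncard_sdiff_singleton_add_one he hf
  omega

/-- **Shannon's theorem**: a multigraph whose degrees are at most `Δ` has a proper edge coloring
with `⌊3Δ/2⌋` colors. -/
theorem exists_coloring_of_degree_le (hE : G.edgeSet.Finite) (hL : G.Loopless) {Δ : ℕ}
    (hΔ : ∀ v ∈ G.vertexSet, G.degree v ≤ Δ) (hk : 3 * Δ ≤ 2 * k + 1) :
    ∃ c, G.IsPartialColoring c ∧ ∀ e ∈ G.edgeSet, c e ∈ Set.Icc 1 k := by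
  classical
  let n : (β → ℕ) → ℕ := fun c => {e | e ∈ G.edgeSet ∧ c e = 0}.ncard
  have hfin : ∀ c : β → ℕ, {e | e ∈ G.edgeSet ∧ c e = 0}.Finite := fun c =>
    hE.subset fun e he => he.1
  -- Take a partial coloring with the fewest uncolored edges (color 0).
  obtain ⟨c, ⟨hc, hck⟩, hmin⟩ := (InvImage.wf n Nat.lt_wfRel.wf).has_min
    {c | G.IsPartialColoring c ∧ ∀ e, c e ≤ k}
    ⟨fun _ => 0, fun _ _ _ _ _ _ h => absurd rfl h, fun _ => Nat.zero_le _⟩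
  have hmin' : ∀ c', G.IsPartialColoring c' → (∀ e, c' e ≤ k) → n c ≤ n c' :=
    fun c' h1 h2 => not_lt.1 (hmin c' ⟨h1, h2⟩)
  refine ⟨c, hc, fun e he => ⟨Nat.one_le_iff_ne_zero.2 fun h0 => ?_, hck e⟩⟩
  -- an uncolored edge of a maximal partial coloring has no common missing color
  have hfree : ∀ c', G.IsPartialColoring c' → (∀ e, c' e ≤ k) → n c' ≤ n c → ∀ u v,
      G.IsLink e u v → c' e = 0 → ∀ i, 1 ≤ i → i ≤ k → ¬G.Sees c' u i → ¬G.Sees c' v i →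
      False := by
    intro c' h1 h2 h3 u v hl h0 i hi hik hu hv
    have := hmin' _ (h1.update_of_not_sees hl hu hv) (fun f => by
      by_cases hf : f = e
      · subst hf; rwa [Function.update_self]
      · rw [Function.update_of_ne hf]; exact h2 f)
    have hlt : n (Function.update c' e i) < n c' := by
      refine Set.ncard_lt_ncard ⟨fun f hf => ?_, fun hss => ?_⟩ (hfin c')
      · obtain ⟨hfE, hf0⟩ := hf
        by_cases hfe : f = e
        · subst hfe; rw [Function.update_self] at hf0; omega
        · rw [Function.update_of_ne hfe] at hf0; exact ⟨hfE, hf0⟩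
      · have := (hss ⟨he, h0⟩).2
        rw [Function.update_self] at this
        omega
    omega
  -- shifting the color of an adjacent edge
  have hshift : ∀ c', G.IsPartialColoring c' → (∀ e, c' e ≤ k) → n c' ≤ n c → ∀ u v w f,
      G.IsLink e u v → G.IsLink f v w → c' e = 0 → 1 ≤ c' f → ¬G.Sees c' u (c' f) →
      ∀ i, 1 ≤ i → i ≤ k → ¬G.Sees c' v i → ¬G.Sees c' w i → False := by
    intro c' h1 h2 h3 u v w f hl hlf h0 hf hu i hi hik hv hw
    have hfu : ¬G.Inc f u := fun h => hu ⟨f, h, rfl⟩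
    have hef : e ≠ f := by rintro rfl; omega
    have hi' : i ≠ c' f := by rintro rfl; exact hv ⟨f, hlf.inc_left, rfl⟩
    refine hfree _ (h1.update_of_not_sees hlf hv hw) (fun g => ?_) ?_ u v hl
      (by rwa [Function.update_of_ne hef]) (c' f) hf (h2 f) ?_ ?_
    · by_cases hg : g = f
      · subst hg; rwa [Function.update_self]
      · rw [Function.update_of_ne hg]; exact h2 g
    · refine le_trans (Set.ncard_le_ncard (fun g hg => ?_) (hfin c')) h3
      obtain ⟨hgE, hg0⟩ := hg
      by_cases hgf : g = f
      · subst hgf; rw [Function.update_self] at hg0; omega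
      · rw [Function.update_of_ne hgf] at hg0; exact ⟨hgE, hg0⟩
    · rwa [sees_update_of_not_inc hfu]
    · rw [h1.sees_update hlf.inc_left (by omega)]
      rintro (h | h)
      · exact hi' h.symm
      · exact h.2 rfl
  have hswap : ∀ a b C, 1 ≤ a → a ≤ k → 1 ≤ b → b ≤ k → G.IsKempeClosed c a b C →
      G.IsPartialColoring (G.swapOn c a b C) ∧ (∀ e, G.swapOn c a b C e ≤ k) ∧
        n (G.swapOn c a b C) ≤ n c := by
    intro a b C ha hak hb hbk hC
    refine ⟨hC.isPartialColoring_swapOn hc (by omega) (by omega), fun g => ?_, ?_⟩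
    · have := hck g
      rcases swapOn_cases (G := G) (c := c) (a := a) (b := b) (C := C) (e := g) with h | h | h <;>
        omega
    · refine Set.ncard_le_ncard (fun g hg => ⟨hg.1, ?_⟩) (hfin c)
      exact (swapOn_eq_iff (by omega) (by omega)).1 hg.2
  obtain ⟨u, v, hl⟩ := G.exists_isLink_of_mem_edgeSet he
  have hMu := lt_card_missingColors_add_degree (k := k) hE hl.inc_left h0
  have hMv := lt_card_missingColors_add_degree (k := k) hE hl.inc_right h0
  have hdu := hΔ u hl.left_mem
  have hdv := hΔ v hl.right_mem
  have huv : Disjoint (G.missingColors c k u) (G.missingColors c k v) := by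
    refine Finset.disjoint_left.2 fun i hi hi' => ?_
    rw [mem_missingColors] at hi hi'
    exact hfree c hc hck le_rfl u v hl h0 i hi.1.1 hi.1.2 hi.2 hi'.2
  -- A color `a` missing at `u` appears at `v`, on an edge `f = vw`. The missing sets of `u`, `v`,
  -- `w` will turn out pairwise disjoint.
  obtain ⟨a, ha⟩ : (G.missingColors c k u).Nonempty := Finset.card_pos.1 (by omega)
  obtain ⟨b, hb⟩ : (G.missingColors c k v).Nonempty := Finset.card_pos.1 (by omega)
  have hav := Finset.disjoint_left.1 huv ha
  rw [mem_missingColors] at ha hb hav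
  obtain ⟨f, hfv, hfa⟩ : G.Sees c v a := by tauto
  obtain ⟨w, hlf⟩ := hfv
  have hvw : v ≠ w := hlf.ne
  have hNuv : u ≠ v := hl.ne
  have huw : u ≠ w := by
    rintro rfl
    exact ha.2 ⟨f, hlf.inc_right, hfa⟩
  have hMw := le_card_missingColors_add_degree (c := c) (k := k) (v := w) hE
  have hdw := hΔ w hlf.right_mem
  have hvw' : Disjoint (G.missingColors c k v) (G.missingColors c k w) := by
    refine Finset.disjoint_left.2 fun i hi hi' => ?_
    rw [mem_missingColors] at hi hi'
    exact hshift c hc hck le_rfl u v w f hl hlf h0 (by omega) (hfa ▸ ha.2) i hi.1.1 hi.1.2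
      hi.2 hi'.2
  have huw' : Disjoint (G.missingColors c k u) (G.missingColors c k w) := by
    refine Finset.disjoint_left.2 fun i hi hi' => ?_
    rw [mem_missingColors] at hi hi'
    have hdeg : ∀ z, ¬(G.Sees c z b ∧ G.Sees c z i) → ∀ x y,
        (G.kempeGraph c b i Set.univ).Adj z x → (G.kempeGraph c b i Set.univ).Adj z y → x = y :=
      fun z hz => hc.kempeGraph_degree_le_one (by omega) (by omega) hz
        fun e _ _ _ h => absurd (Set.mem_univ e) h
    -- With `R = Set.univ` these are the ordinary Kempe chains. All of `u`, `v`, `w` are chain ends,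
    -- so either `w` or `u` can be swapped without touching `v`, which makes `b` missing there too.
    have h3 := (G.kempeGraph c b i Set.univ).not_reachable_of_degree_le_one
      (fun w x y z => hc.kempeGraph_degree_le_two (by omega) (by omega)) hNuv huw hvw
      (hdeg u (by tauto)) (hdeg v (by tauto)) (hdeg w (by tauto))
    by_cases hr : (G.kempeGraph c b i Set.univ).Reachable u v
    · have hC := isKempeClosed_reachable (G := G) (c := c) (a := b) (b := i) (R := Set.univ)
        (u := w)
      obtain ⟨k1, k2, k3⟩ := hswap b i _ hb.1.1 hb.1.2 hi.1.1 hi.1.2 hC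
      have hwu : u ∉ {z | (G.kempeGraph c b i Set.univ).Reachable w z} :=
        fun h => h3 hr (SimpleGraph.Reachable.symm h)
      have hwv : v ∉ {z | (G.kempeGraph c b i Set.univ).Reachable w z} :=
        fun h => h3 hr (hr.trans (SimpleGraph.Reachable.symm h))
      have hww : w ∈ {z | (G.kempeGraph c b i Set.univ).Reachable w z} :=
        SimpleGraph.Reachable.refl w
      have hf' := hC.swapOn_of_notMem hwv hlf.inc_left
      refine hshift _ k1 k2 k3 u v w f hl hlf
        ((hC.swapOn_of_notMem hwv hl.inc_right).trans h0) (by omega) ?_ b hb.1.1 hb.1.2 ?_ ?_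
      · rw [hf', hC.sees_swapOn_of_notMem hwu, hfa]; exact ha.2
      · rw [hC.sees_swapOn_of_notMem hwv]; exact hb.2
      · rw [sees_swapOn_of_mem_left hww]; exact hi'.2
    · have hC := isKempeClosed_reachable (G := G) (c := c) (a := b) (b := i) (R := Set.univ)
        (u := u)
      have huu : u ∈ {z | (G.kempeGraph c b i Set.univ).Reachable u z} :=
        SimpleGraph.Reachable.refl u
      obtain ⟨k1, k2, k3⟩ := hswap b i _ hb.1.1 hb.1.2 hi.1.1 hi.1.2 hC
      refine hfree _ k1 k2 k3 u v hl ((hC.swapOn_of_notMem hr hl.inc_right).trans h0) b hb.1.1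
        hb.1.2 ?_ ?_
      · rw [sees_swapOn_of_mem_left huu]; exact hi.2
      · rw [hC.sees_swapOn_of_notMem hr]; exact hb.2
  -- Disjointness gives `2(k + 1 - Δ) + (k - Δ) ≤ k`, the extra 1 at `u` and `v` coming from the
  -- uncolored edge. This contradicts `3Δ ≤ 2k + 1`.
  have hcard : ((G.missingColors c k u ∪ G.missingColors c k v) ∪ G.missingColors c k w).card
      ≤ (Finset.Icc 1 k).card :=
    Finset.card_le_card (Finset.union_subset (Finset.union_subset (Finset.filter_subset _ _)
      (Finset.filter_subset _ _)) (Finset.filter_subset _ _))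
  rw [Finset.card_union_of_disjoint (Finset.disjoint_union_left.2 ⟨huw', hvw'⟩),
    Finset.card_union_of_disjoint huv, Nat.card_Icc] at hcard
  omega

end Graph

/-! ### Interval colorings from three colors -/

namespace Graph

variable {α β : Type*} {G : Graph α β}

/-- A coloring with colors `1`, `2`, `3` without conflicts between `1` and `2` can be turned into an
interval coloring. -/
theorem intervalColorable_of_no_conflict {c : β → ℕ} (hc : G.IsPartialColoring c)
    (h3 : ∀ e ∈ G.edgeSet, c e = 1 ∨ c e = 2 ∨ c e = 3) (hno : ∀ m, ¬G.IsConflict c 1 2 m) :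
    G.IntervalColorable := by
  classical
  -- An end seeing 2 but not 1 forces the new color 4. Otherwise 1 is safe.
  let P : β → Prop := fun e => ∃ v, G.Inc e v ∧ G.Sees c v 2 ∧ ¬G.Sees c v 1
  let d : β → ℕ := fun e => if c e = 1 then 2 else if c e = 2 then 3 else if P e then 4 else 1
  have d1 : ∀ {e}, c e = 1 → d e = 2 := fun h => if_pos h
  have d2 : ∀ {e}, c e = 2 → d e = 3 := fun {e} h => by simp [d, h]
  have d3 : ∀ {e}, c e = 3 → (P e ∧ d e = 4) ∨ (¬P e ∧ d e = 1) := fun {e} h => by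
    by_cases hP : P e <;> simp [d, h, hP]
  have hcd : ∀ e ∈ G.edgeSet, (c e = 1 ∧ d e = 2) ∨ (c e = 2 ∧ d e = 3) ∨
      (c e = 3 ∧ P e ∧ d e = 4) ∨ (c e = 3 ∧ ¬P e ∧ d e = 1) := by
    intro e he
    rcases h3 e he with h | h | h
    · exact Or.inl ⟨h, d1 h⟩
    · exact Or.inr (Or.inl ⟨h, d2 h⟩)
    · rcases d3 h with h' | h'
      · exact Or.inr (Or.inr (Or.inl ⟨h, h'⟩))
      · exact Or.inr (Or.inr (Or.inr ⟨h, h'⟩))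
  have hd4 : ∀ e ∈ G.edgeSet, d e = 4 → c e = 3 ∧ P e := by
    intro e he h
    rcases hcd e he with ⟨-, h'⟩ | ⟨-, h'⟩ | ⟨h1, h2, -⟩ | ⟨-, -, h'⟩
    · omega
    · omega
    · exact ⟨h1, h2⟩
    · omega
  have hd1 : ∀ e ∈ G.edgeSet, d e = 1 → ¬P e := by
    intro e he h
    rcases hcd e he with ⟨-, h'⟩ | ⟨-, h'⟩ | ⟨-, -, h'⟩ | ⟨-, h1, -⟩
    · omega
    · omega
    · omega
    · exact h1
  refine ⟨4, d, ⟨⟨fun e he => ?_, fun e f v he hf hef hd => hef ?_⟩, fun v hv => ?_⟩⟩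
  · rcases hcd e he with h | h | h | h <;> simp [h]
  · have h1 := hcd e he.edge_mem
    have h2 := hcd f hf.edge_mem
    exact hc he hf (by omega) (by omega)
  · have s2 : 2 ∈ d '' G.incidenceSet v ↔ G.Sees c v 1 := by
      constructor
      · rintro ⟨e, he, hd⟩
        have := hcd e he.edge_mem
        exact ⟨e, he, by omega⟩
      · rintro ⟨e, he, h⟩; exact ⟨e, he, d1 h⟩
    have s3 : 3 ∈ d '' G.incidenceSet v ↔ G.Sees c v 2 := by
      constructor
      · rintro ⟨e, he, hd⟩
        have := hcd e he.edge_mem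
        exact ⟨e, he, by omega⟩
      · rintro ⟨e, he, h⟩; exact ⟨e, he, d2 h⟩
    have s14 : 1 ∈ d '' G.incidenceSet v → 4 ∉ d '' G.incidenceSet v := by
      rintro ⟨e, he, hd⟩ ⟨f, hf, hd'⟩
      have h1 := hcd e he.edge_mem
      have h2 := hcd f hf.edge_mem
      have : e = f := hc he hf (by omega) (by omega)
      subst this
      omega
    have s1 : 1 ∈ d '' G.incidenceSet v → G.Sees c v 2 → G.Sees c v 1 := by
      rintro ⟨e, he, hd⟩ h
      by_contra h'
      exact hd1 e he.edge_mem hd ⟨v, he, h, h'⟩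
    have s4 : 4 ∈ d '' G.incidenceSet v → G.Sees c v 1 → G.Sees c v 2 := by
      rintro ⟨e, he, hd⟩ h
      by_contra h'
      obtain ⟨hce, w, hew, hw2, hw1⟩ := hd4 e he.edge_mem hd
      refine hno e ⟨hce, v, w, ?_, h, h', hw2, hw1⟩
      have hvw : v ≠ w := by rintro rfl; exact hw1 h
      obtain ⟨y, hy⟩ := he
      rcases hew.eq_or_eq_of_isLink hy with rfl | rfl
      · exact absurd rfl hvw
      · exact hy
    rw [← s2, ← s3] at s1 s4
    have hsub : ∀ i, i ∈ d '' G.incidenceSet v → i = 1 ∨ i = 2 ∨ i = 3 ∨ i = 4 := by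
      rintro i ⟨e, he, rfl⟩
      have := hcd e he.edge_mem
      omega
    clear_value d
    clear s2 s3
    generalize d '' G.incidenceSet v = S at *
    have key : ∀ a b, (∀ i ∈ ({1, 2, 3, 4} : Finset ℕ), i ∈ S ↔ a ≤ i ∧ i ≤ b) → 1 ≤ a → b ≤ 4 →
        S = Set.Icc a b := by
      intro a b h ha hb
      ext i
      by_cases hi : i ∈ ({1, 2, 3, 4} : Finset ℕ)
      · exact h i hi
      · simp only [Finset.mem_insert, Finset.mem_singleton, not_or] at hi
        constructor
        · intro hS; have := hsub i hS; omega
        · rintro ⟨h1, h2⟩; omega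
    -- The constraints `s1`, `s4`, `s14` leave ten subsets of `{1, 2, 3, 4}`, all of them intervals.
    by_cases m1 : 1 ∈ S <;> by_cases m2 : 2 ∈ S <;> by_cases m3 : 3 ∈ S <;> by_cases m4 : 4 ∈ S <;>
      simp only [m1, m2, m3, m4, not_true_eq_false, not_false_eq_true, forall_const,
        imp_false] at s1 s4 s14
    · exact ⟨1, 3, key _ _ (by simp [*]) (by norm_num) (by norm_num)⟩
    · exact ⟨1, 2, key _ _ (by simp [*]) (by norm_num) (by norm_num)⟩
    · exact ⟨1, 1, key _ _ (by simp [*]) (by norm_num) (by norm_num)⟩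
    · exact ⟨2, 4, key _ _ (by simp [*]) (by norm_num) (by norm_num)⟩
    · exact ⟨2, 3, key _ _ (by simp [*]) (by norm_num) (by norm_num)⟩
    · exact ⟨2, 2, key _ _ (by simp [*]) (by norm_num) (by norm_num)⟩
    · exact ⟨3, 4, key _ _ (by simp [*]) (by norm_num) (by norm_num)⟩
    · exact ⟨3, 3, key _ _ (by simp [*]) (by norm_num) (by norm_num)⟩
    · exact ⟨4, 4, key _ _ (by simp [*]) (by norm_num) (by norm_num)⟩
    · exact ⟨1, 0, key _ _ (by simp [*]) (by norm_num) (by norm_num)⟩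

end Graph

/-! ### Optimal 5-edge colorings -/

namespace Graph

variable {α β : Type*} {G : Graph α β}

/-- The number of edges of color `3`. -/
noncomputable def middleCount (G : Graph α β) (c : β → ℕ) : ℕ := {m ∈ G.edgeSet | c m = 3}.ncard

/-- The number of conflicts between `a` and `b`. -/
noncomputable def conflictCount (G : Graph α β) (c : β → ℕ) (a b : ℕ) : ℕ :=
  {m | G.IsConflict c a b m}.ncard

/-- The number of edges in conflict both between `1`, `2` and between `4`, `5`. -/
noncomputable def doubleCount (G : Graph α β) (c : β → ℕ) : ℕ :=
  {m | G.IsConflict c 1 2 m ∧ G.IsConflict c 4 5 m}.ncard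

/-- A proper coloring with colors from `{1, …, k}`. -/
structure IsColoring (G : Graph α β) (k : ℕ) (c : β → ℕ) : Prop where
  proper : G.IsPartialColoring c
  mem : ∀ e ∈ G.edgeSet, 1 ≤ c e ∧ c e ≤ k

/-- A proper `5`-edge coloring that lexicographically minimizes the number of edges of color `3`,
the number of conflicts, and the number of double conflicts. -/
structure IsOptimal (G : Graph α β) (c : β → ℕ) : Prop extends G.IsColoring 5 c where
  middle_le : ∀ c', G.IsColoring 5 c' → G.middleCount c ≤ G.middleCount c'
  conflict_le : ∀ c', G.IsColoring 5 c' → G.middleCount c' ≤ G.middleCount c →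
    G.conflictCount c 1 2 + G.conflictCount c 4 5 ≤
      G.conflictCount c' 1 2 + G.conflictCount c' 4 5
  double_le : ∀ c', G.IsColoring 5 c' → G.middleCount c' ≤ G.middleCount c →
    G.conflictCount c' 1 2 + G.conflictCount c' 4 5 ≤
      G.conflictCount c 1 2 + G.conflictCount c 4 5 → G.doubleCount c ≤ G.doubleCount c'

theorem exists_isOptimal {c₀ : β → ℕ} (h₀ : G.IsColoring 5 c₀) : ∃ c, G.IsOptimal c := by
  let μ : (β → ℕ) → ℕ ×ₗ ℕ ×ₗ ℕ := fun c => toLex (G.middleCount c,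
    toLex (G.conflictCount c 1 2 + G.conflictCount c 4 5, G.doubleCount c))
  obtain ⟨c, hc, hmin⟩ := (InvImage.wf μ wellFounded_lt).has_min {c | G.IsColoring 5 c} ⟨c₀, h₀⟩
  have key : ∀ c', G.IsColoring 5 c' → ¬μ c' < μ c := fun c' h => hmin c' h
  refine ⟨c, hc, fun c' h => ?_, fun c' h h1 => ?_, fun c' h h1 h2 => ?_⟩
  all_goals
    by_contra hlt
    apply key c' h
    simp only [μ, Prod.Lex.toLex_lt_toLex]
    omega

variable {c c' : β → ℕ} {a b i j k l : ℕ} {C : Set α} {e m p q : β} {u v w x y : α}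

theorem conflictCount_le (hE : G.edgeSet.Finite)
    (h : ∀ m, G.IsConflict c' a b m → G.IsConflict c a b m) :
    G.conflictCount c' a b ≤ G.conflictCount c a b :=
  Set.ncard_le_ncard h (hE.subset fun _ h => h.edge_mem)

theorem conflictCount_lt (hE : G.edgeSet.Finite) (hp : G.IsConflict c a b p)
    (hp' : ¬G.IsConflict c' a b p) (h : ∀ m ≠ p, G.IsConflict c' a b m → G.IsConflict c a b m) :
    G.conflictCount c' a b < G.conflictCount c a b := by
  refine Set.ncard_lt_ncard ⟨fun m hm => h m ?_ hm, fun hss => hp' (hss hp)⟩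
    (hE.subset fun _ h => h.edge_mem)
  rintro rfl
  exact hp' hm

/-- Resolving `p` pays for at most one new conflict. In the applications `S` holds the edge of color
3 at `x`. -/
theorem conflictCount_le_of_subsingleton (hE : G.edgeSet.Finite) (hp : G.IsConflict c a b p)
    (hp' : ¬G.IsConflict c' a b p) (S : Set β) (hS : S.Subsingleton)
    (h : ∀ m ≠ p, m ∉ S → G.IsConflict c' a b m → G.IsConflict c a b m) :
    G.conflictCount c' a b ≤ G.conflictCount c a b := by
  have hf : {m | G.IsConflict c a b m}.Finite := hE.subset fun _ h => h.edge_mem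
  have h1 : {m | G.IsConflict c' a b m} ⊆ ({m | G.IsConflict c a b m} \ {p}) ∪ S := by
    intro m hm
    by_cases hmS : m ∈ S
    · exact Or.inr hmS
    · have hmp : m ≠ p := by rintro rfl; exact hp' hm
      exact Or.inl ⟨h m hmp hmS hm, hmp⟩
  have h2 := Set.ncard_le_ncard h1 ((hf.subset Set.sdiff_subset).union hS.finite)
  have h3 := Set.ncard_union_le ({m | G.IsConflict c a b m} \ {p}) S
  have h4 := (Set.ncard_le_one hS.finite).2 fun _ ha _ hb => hS ha hb
  have h5 : ({m | G.IsConflict c a b m} \ {p}).ncard + 1 = _ :=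
    Set.ncard_sdiff_singleton_add_one hp hf
  unfold conflictCount
  omega

theorem doubleCount_lt (hE : G.edgeSet.Finite) (hp : G.IsConflict c 1 2 p ∧ G.IsConflict c 4 5 p)
    (hp' : ¬(G.IsConflict c' 1 2 p ∧ G.IsConflict c' 4 5 p))
    (h : ∀ m ≠ p, G.IsConflict c' 1 2 m → G.IsConflict c' 4 5 m →
      G.IsConflict c 1 2 m ∧ G.IsConflict c 4 5 m) :
    G.doubleCount c' < G.doubleCount c := by
  refine Set.ncard_lt_ncard ⟨fun m hm => h m ?_ hm.1 hm.2, fun hss => hp' (hss hp)⟩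
    (hE.subset fun _ h => h.1.edge_mem)
  rintro rfl
  exact hp' hm

theorem middleCount_swapOn (ha : a ≠ 3) (hb : b ≠ 3) :
    G.middleCount (G.swapOn c a b C) = G.middleCount c := by
  unfold middleCount
  congr 1
  ext m
  simp only [Set.mem_ofPred_eq, swapOn_eq_iff (G := G) (c := c) (C := C) ha.symm hb.symm]

theorem middleCount_update_le [DecidableEq β] (hE : G.edgeSet.Finite) (hi : i ≠ 3) :
    G.middleCount (Function.update c e i) ≤ G.middleCount c := by
  refine Set.ncard_le_ncard (fun m hm => ⟨hm.1, ?_⟩) (hE.subset fun _ h => h.1)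
  have := hm.2
  by_cases hme : m = e
  · subst hme; rw [Function.update_self] at this; exact absurd this hi
  · rwa [Function.update_of_ne hme] at this

theorem middleCount_update_lt [DecidableEq β] (hE : G.edgeSet.Finite) (he : e ∈ G.edgeSet)
    (hce : c e = 3) (hi : i ≠ 3) :
    G.middleCount (Function.update c e i) < G.middleCount c := by
  refine Set.ncard_lt_ncard ⟨fun m hm => ⟨hm.1, ?_⟩, fun hss => ?_⟩ (hE.subset fun _ h => h.1)
  · have := hm.2
    by_cases hme : m = e
    · subst hme; exact hce
    · rwa [Function.update_of_ne hme] at this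
  · have := (hss ⟨he, hce⟩).2
    rw [Function.update_self] at this
    exact hi this

theorem middleCount_update_le_add_one [DecidableEq β] (hE : G.edgeSet.Finite) :
    G.middleCount (Function.update c e i) ≤ G.middleCount c + 1 := by
  have hf : {m ∈ G.edgeSet | c m = 3}.Finite := hE.subset fun _ h => h.1
  refine (Set.ncard_le_ncard (t := insert e {m ∈ G.edgeSet | c m = 3}) (fun m hm => ?_)
    (hf.insert e)).trans (Set.ncard_insert_le _ _)
  by_cases hme : m = e
  · exact Or.inl hme
  · have := hm.2
    rw [Function.update_of_ne hme] at this
    exact Or.inr ⟨hm.1, this⟩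

theorem IsColoring.swapOn (h : G.IsColoring k c) (hC : G.IsKempeClosed c a b C)
    (ha : 1 ≤ a ∧ a ≤ k) (hb : 1 ≤ b ∧ b ≤ k) : G.IsColoring k (G.swapOn c a b C) := by
  refine ⟨hC.isPartialColoring_swapOn h.proper (by omega) (by omega), fun e he => ?_⟩
  have := h.mem e he
  rcases swapOn_cases (G := G) (c := c) (a := a) (b := b) (C := C) (e := e) with h | h | h <;>
    omega

theorem IsColoring.update [DecidableEq β] (h : G.IsColoring k c) (hl : G.IsLink e u v)
    (hi : 1 ≤ i ∧ i ≤ k) (hu : ¬G.Sees c u i) (hv : ¬G.Sees c v i) :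
    G.IsColoring k (Function.update c e i) := by
  refine ⟨h.proper.update_of_not_sees hl hu hv, fun f hf => ?_⟩
  by_cases hfe : f = e
  · subst hfe; rwa [Function.update_self]
  · rw [Function.update_of_ne hfe]; exact h.mem f hf

theorem eq_three_of_update_eq_three [DecidableEq β] (hi : i ≠ 3)
    (h : Function.update c e i m = 3) : c m = 3 := by
  by_cases hme : m = e
  · subst hme; rw [Function.update_self] at h; exact absurd h hi
  · rwa [Function.update_of_ne hme] at h

theorem IsConflict.of_update [DecidableEq β] (hl : G.IsLink e u x) (hi : i ≠ 3)
    (h : G.IsConflict (Function.update c e i) a b m) (hu : ¬G.Inc m u) (hx : ¬G.Inc m x) :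
    G.IsConflict c a b m := by
  refine h.congr (eq_three_of_update_eq_three hi h.1) fun v hv => ?_
  have hev : ¬G.Inc e v := by
    intro hev
    rcases hev.eq_or_eq_of_isLink hl with rfl | rfl
    · exact hu hv
    · exact hx hv
  exact ⟨sees_update_of_not_inc hev, sees_update_of_not_inc hev⟩

theorem IsPartialColoring.sees_update_of_ne [DecidableEq β] (hc : G.IsPartialColoring c)
    (hj : j ≠ 0) (hji : j ≠ i) (hje : j ≠ c e) :
    G.Sees (Function.update c e i) v j ↔ G.Sees c v j := by
  by_cases he : G.Inc e v
  · rw [hc.sees_update he hj]; tauto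
  · exact sees_update_of_not_inc he

theorem IsConflict.of_update_of_ne [DecidableEq β] (hc : G.IsPartialColoring c)
    (ha : a ≠ 0) (hai : a ≠ i) (hae : a ≠ c e) (hb : b ≠ 0) (hbi : b ≠ i) (hbe : b ≠ c e)
    (hi : i ≠ 3) (h : G.IsConflict (Function.update c e i) a b m) : G.IsConflict c a b m :=
  h.congr (eq_three_of_update_eq_three hi h.1) fun _ _ =>
    ⟨hc.sees_update_of_ne ha hai hae, hc.sees_update_of_ne hb hbi hbe⟩

/-- No edge of color `3` can be recolored. -/
theorem IsOptimal.sees_of_not_sees (h : G.IsOptimal c) (hE : G.edgeSet.Finite)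
    (hq : G.IsLink q x y) (hq3 : c q = 3) (hi : 1 ≤ i ∧ i ≤ 5) (hi3 : i ≠ 3)
    (hx : ¬G.Sees c x i) : G.Sees c y i := by
  classical
  by_contra hy
  have h1 := h.middle_le _ (h.toIsColoring.update hq hi hx hy)
  have h2 := middleCount_update_lt (i := i) hE hq.edge_mem hq3 hi3
  omega

theorem IsPartialColoring.subsingleton_middle (hc : G.IsPartialColoring c) (x : α) :
    {m | G.Inc m x ∧ c m = 3}.Subsingleton :=
  fun _ h _ h' => hc h.1 h'.1 (h.2.trans h'.2.symm) (by rw [h.2]; norm_num)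

/-- An edge `p = uv` in double conflict, together with the edge `e = ux` of color `1`. -/
structure IsDouble (G : Graph α β) (c : β → ℕ) (p e : β) (u v x : α) : Prop where
  opt : G.IsOptimal c
  left : G.IsConflict c 1 2 p
  right : G.IsConflict c 4 5 p
  link : G.IsLink p u v
  link_e : G.IsLink e u x
  color_e : c e = 1

/-! ### Double conflicts in an optimal coloring -/

namespace IsDouble

theorem color_p (h : G.IsDouble c p e u v x) : c p = 3 := h.left.1

theorem sees_u (h : G.IsDouble c p e u v x) : G.Sees c u 1 := ⟨e, h.link_e.inc_left, h.color_e⟩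

theorem sees_x (h : G.IsDouble c p e u v x) : G.Sees c x 1 := ⟨e, h.link_e.inc_right, h.color_e⟩

theorem not_sees_u (h : G.IsDouble c p e u v x) : ¬G.Sees c u 2 :=
  (h.left.of_sees h.link h.sees_u).1

theorem sees_v (h : G.IsDouble c p e u v x) : G.Sees c v 2 :=
  (h.left.of_sees h.link h.sees_u).2.1

theorem not_sees_v (h : G.IsDouble c p e u v x) : ¬G.Sees c v 1 :=
  (h.left.of_sees h.link h.sees_u).2.2

theorem v_ne_x (h : G.IsDouble c p e u v x) : v ≠ x := by
  rintro rfl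
  exact h.not_sees_v h.sees_x

theorem eq_p (h : G.IsDouble c p e u v x) (hm : c m = 3) (hmu : G.Inc m u ∨ G.Inc m v) :
    m = p := by
  have h3 := h.color_p
  rcases hmu with hmu | hmu
  · exact h.opt.proper hmu h.link.inc_left (by omega) (by omega)
  · exact h.opt.proper hmu h.link.inc_right (by omega) (by omega)

theorem p_not_inc_x (hL : G.Loopless) (h : G.IsDouble c p e u v x) : ¬G.Inc p x := by
  intro hp
  rcases hp.eq_or_eq_of_isLink h.link with hx | hx
  · exact h.link_e.ne hx.symm
  · exact h.v_ne_x hx.symm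

theorem not_inc_of_isLink (hL : G.Loopless) (h : G.IsDouble c p e u v x) (hq : G.IsLink q x y)
    (hq3 : c q = 3) : ¬G.Inc e y ∧ y ≠ u ∧ y ≠ v := by
  have hqp : ¬(G.Inc q u ∨ G.Inc q v) := fun h' =>
    h.p_not_inc_x hL (h.eq_p hq3 h' ▸ hq.inc_left)
  have hyu : y ≠ u := by rintro rfl; exact hqp (Or.inl hq.inc_right)
  have hyv : y ≠ v := by rintro rfl; exact hqp (Or.inr hq.inc_right)
  refine ⟨fun hey => ?_, hyu, hyv⟩
  rcases hey.eq_or_eq_of_isLink h.link_e with hy | hy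
  · exact hyu hy
  · exact hq.ne hy.symm

/-- The edge `e` cannot be recolored by the color from `{4, 5}` missing at `u`. -/
theorem sees_x_of_not_sees_u (hE : G.edgeSet.Finite) (hL : G.Loopless)
    (h : G.IsDouble c p e u v x) (hab : (a = 4 ∧ b = 5) ∨ (a = 5 ∧ b = 4))
    (hua : G.Sees c u a) : G.Sees c x b := by
  classical
  by_contra hxb
  have hc := h.opt.proper
  have hce := h.color_e
  have hB : ∀ {d m}, G.IsConflict d 4 5 m ↔ G.IsConflict d a b m := by
    rcases hab with ⟨rfl, rfl⟩ | ⟨rfl, rfl⟩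
    · exact Iff.rfl
    · exact isConflict_comm
  obtain ⟨hub, hvb, hva⟩ := (hB.1 h.right).of_sees h.link hua
  have hu : ∀ j, j ≠ 0 → (G.Sees (Function.update c e b) u j ↔ j = b ∨ G.Sees c u j ∧ j ≠ c e) :=
    fun j => hc.sees_update h.link_e.inc_left
  have hx : ∀ j, j ≠ 0 → (G.Sees (Function.update c e b) x j ↔ j = b ∨ G.Sees c x j ∧ j ≠ c e) :=
    fun j => hc.sees_update h.link_e.inc_right
  have hcol := h.opt.toIsColoring.update h.link_e (i := b) (by omega) hub hxb
  -- After recoloring, `u` sees neither 1 nor 2, so `p` is resolved. Only the edge of color 3 at `x`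
  -- can be a new conflict.
  have h1 : G.conflictCount (Function.update c e b) 1 2 ≤ G.conflictCount c 1 2 := by
    refine conflictCount_le_of_subsingleton hE h.left
      (not_isConflict_of_not_sees h.link.inc_left ?_ ?_) _ (hc.subsingleton_middle x)
      fun m hmp hmx hm => ?_
    · rw [hu 1 (by omega)]; omega
    · rw [hu 2 (by omega)]
      rintro (h' | h')
      · omega
      · exact h.not_sees_u h'.1
    · have hm3 := eq_three_of_update_eq_three (by omega) hm.1
      exact hm.of_update h.link_e (by omega) (fun hi => hmp (h.eq_p hm3 (Or.inl hi)))
        fun hi => hmx ⟨hi, hm3⟩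
  have h2 : G.conflictCount (Function.update c e b) 4 5 < G.conflictCount c 4 5 := by
    refine conflictCount_lt hE h.right ?_ fun m hmp hm => ?_
    · rw [hB]
      refine not_isConflict_of_sees h.link.inc_left ?_ ?_
      · rw [hu a (by omega)]; exact Or.inr ⟨hua, by omega⟩
      · rw [hu b (by omega)]; exact Or.inl rfl
    · have hm3 := eq_three_of_update_eq_three (by omega) hm.1
      by_cases hmx : G.Inc m x
      · exfalso
        -- If `x` misses both `a` and `b`, then `y` sees both, since no edge of color 3 can be
        -- recolored.
        by_cases hxa : G.Sees c x a
        · refine not_isConflict_of_sees hmx ?_ ?_ (hB.1 hm)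
          · rw [hx a (by omega)]; exact Or.inr ⟨hxa, by omega⟩
          · rw [hx b (by omega)]; exact Or.inl rfl
        · obtain ⟨y, hy⟩ := hmx
          have hey := (h.not_inc_of_isLink hL hy hm3).1
          refine not_isConflict_of_sees hy.inc_right ?_ ?_ (hB.1 hm)
          · rw [sees_update_of_not_inc hey]
            exact h.opt.sees_of_not_sees hE hy hm3 (by omega) (by omega) hxa
          · rw [sees_update_of_not_inc hey]
            exact h.opt.sees_of_not_sees hE hy hm3 (by omega) (by omega) hxb
      · exact hm.of_update h.link_e (by omega) (fun hi => hmp (h.eq_p hm3 (Or.inl hi))) hmx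
  have := h.opt.conflict_le _ hcol (middleCount_update_le hE (by omega))
  omega

end IsDouble

end Graph

namespace Graph

variable {α β : Type*} {G : Graph α β} {c : β → ℕ} {a b : ℕ} {e p q : β} {u v x y : α}

namespace IsDouble

/-- Recoloring `e` by `2` resolves the conflict of `p` between `1` and `2`. -/
theorem not_isConflict_update [DecidableEq β] (h : G.IsDouble c p e u v x) :
    ¬G.IsConflict (Function.update c e 2) 1 2 p := by
  intro h'
  have hc := h.opt.proper
  refine (h'.symm.of_sees h.link ((hc.sees_update h.link_e.inc_left (by omega)).2
    (Or.inl rfl))).2.2 ?_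
  by_cases hev : G.Inc e v
  · exact (hc.sees_update hev (by omega)).2 (Or.inl rfl)
  · exact (sees_update_of_not_inc hev).2 h.sees_v

/-- Otherwise `x` misses 2, and recoloring `e` by 2 resolves both `p` and `q` while leaving 4 and 5
untouched. -/
theorem not_isConflict_of_inc_x (hE : G.edgeSet.Finite) (hL : G.Loopless)
    (h : G.IsDouble c p e u v x) (hqx : G.Inc q x) : ¬G.IsConflict c 1 2 q := by
  classical
  intro hq
  have hc := h.opt.proper
  have hce := h.color_e
  obtain ⟨y, hqy⟩ := hqx
  obtain ⟨hx2, hy2, hy1⟩ := hq.of_sees hqy h.sees_x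
  have hcol := h.opt.toIsColoring.update h.link_e (i := 2) (by omega) h.not_sees_u hx2
  have h1 : G.conflictCount (Function.update c e 2) 1 2 < G.conflictCount c 1 2 := by
    refine conflictCount_lt hE h.left h.not_isConflict_update fun m hmp hm => ?_
    have hm3 := eq_three_of_update_eq_three (by omega) hm.1
    refine hm.of_update h.link_e (by omega) (fun hi => hmp (h.eq_p hm3 (Or.inl hi))) fun hmx => ?_
    obtain rfl : m = q := hc.subsingleton_middle x ⟨hmx, hm3⟩ ⟨hqy.inc_left, hq.1⟩
    refine (hm.symm.of_sees hqy ((hc.sees_update h.link_e.inc_right (by omega)).2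
      (Or.inl rfl))).2.2 ?_
    rwa [sees_update_of_not_inc (h.not_inc_of_isLink hL hqy hm3).1]
  have h2 : G.conflictCount (Function.update c e 2) 4 5 ≤ G.conflictCount c 4 5 :=
    conflictCount_le hE fun m hm => hm.of_update_of_ne hc (by omega) (by omega) (by omega)
      (by omega) (by omega) (by omega) (by omega)
  have := h.opt.conflict_le _ hcol (middleCount_update_le hE (by omega))
  omega

theorem sees_x_of_sees_u (hE : G.edgeSet.Finite) (hL : G.Loopless)
    (h : G.IsDouble c p e u v x) (hab : (a = 4 ∧ b = 5) ∨ (a = 5 ∧ b = 4))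
    (hua : G.Sees c u a) : G.Sees c x a := by
  classical
  by_contra hxa
  have hxb := h.sees_x_of_not_sees_u hE hL hab hua
  have hc := h.opt.proper
  have hce := h.color_e
  have hB : ∀ {d m}, G.IsConflict d 4 5 m ↔ G.IsConflict d a b m := by
    rcases hab with ⟨rfl, rfl⟩ | ⟨rfl, rfl⟩
    · exact Iff.rfl
    · exact isConflict_comm
  have hBc : ∀ {d}, G.conflictCount d 4 5 = G.conflictCount d a b := by
    intro d
    unfold conflictCount
    congr 1
    ext m
    exact hB
  obtain ⟨hub, hvb, hva⟩ := (hB.1 h.right).of_sees h.link hua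
  set S : Set β := {m | G.Inc m x ∧ c m = 3} with hS
  have hSs : S.Subsingleton := hc.subsingleton_middle x
  -- Cutting `p` and the edge of color 3 at `x` makes `u`, `v`, `x` chain ends, so they are not all
  -- in one component.
  set R : Set β := {m | m = p ∨ m ∈ S}
  set C : Set α := {z | (G.kempeGraph c a b R).Reachable u z}
  have hC : G.IsKempeClosed c a b C := isKempeClosed_reachable
  have huC : u ∈ C := SimpleGraph.Reachable.refl u
  set d := G.swapOn c a b C
  have hd : G.IsColoring 5 d := h.opt.toIsColoring.swapOn hC (by omega) (by omega)
  have hdm : G.middleCount d = G.middleCount c := middleCount_swapOn (by omega) (by omega)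
  have hd3 : ∀ {m}, d m = 3 ↔ c m = 3 := swapOn_eq_iff (by omega) (by omega)
  have hdua : ¬G.Sees d u a := by rwa [sees_swapOn_of_mem_left huC]
  have hdub : G.Sees d u b := by rwa [sees_swapOn_of_mem_right huC]
  have hdA : ∀ {m}, G.IsConflict d 1 2 m → G.IsConflict c 1 2 m := fun hm =>
    hm.of_swapOn_of_ne (by omega) (by omega) (by omega) (by omega) (by omega) (by omega)
  have hdB : ∀ m ≠ p, m ∉ S → G.IsConflict d a b m → G.IsConflict c a b m :=
    fun m hmp hmS hm => hm.of_swapOn (by omega) (by omega) (R := R) (by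
      rintro (h' | h')
      · exact hmp h'
      · exact hmS h')
  by_cases hxC : x ∈ C
  -- The swap resolves `p` between `a` and `b`. A new conflict can arise only at `x`, where it is
  -- not double, so the number of double conflicts drops.
  · have hvC : v ∉ C := by
      refine fun hvC => (G.kempeGraph c a b R).not_reachable_of_degree_le_one
        (fun w x y z => hc.kempeGraph_degree_le_two (by omega) (by omega)) h.link.ne
        h.link_e.ne h.v_ne_x ?_ ?_ ?_ hvC hxC
      · exact hc.kempeGraph_degree_le_one (by omega) (by omega) (by tauto)
          fun f w hf hf3 hR => absurd (Or.inl (h.eq_p hf3 (Or.inl hf.inc_left))) hR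
      · exact hc.kempeGraph_degree_le_one (by omega) (by omega) (by tauto)
          fun f w hf hf3 hR => absurd (Or.inl (h.eq_p hf3 (Or.inr hf.inc_left))) hR
      · exact hc.kempeGraph_degree_le_one (by omega) (by omega) (by tauto)
          fun f w hf hf3 hR => absurd (Or.inr ⟨hf.inc_left, hf3⟩) hR
    have hp : ¬G.IsConflict d a b p := fun hp => by
      have := (hp.symm.of_sees h.link hdub).2.2
      rw [hC.sees_swapOn_of_notMem hvC] at this
      exact this hvb
    have h1 : G.conflictCount d 1 2 ≤ G.conflictCount c 1 2 := conflictCount_le hE fun m => hdA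
    have h2 : G.conflictCount d a b ≤ G.conflictCount c a b :=
      conflictCount_le_of_subsingleton hE (hB.1 h.right) hp S hSs hdB
    have h3 : G.doubleCount d < G.doubleCount c := by
      refine doubleCount_lt hE ⟨h.left, h.right⟩ (fun h' => hp (hB.1 h'.2)) fun m hmp hm1 hm2 =>
        ⟨hdA hm1, hB.2 (hdB m hmp (fun hmS => ?_) (hB.1 hm2))⟩
      exact h.not_isConflict_of_inc_x hE hL hmS.1 (hdA hm1)
    rw [← hBc, ← hBc] at h2
    have := h.opt.double_le d hd hdm.le (by omega)
    omega
  · have hdxa : ¬G.Sees d x a := by rwa [hC.sees_swapOn_of_notMem hxC]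
    have hdxb : G.Sees d x b := by rwa [hC.sees_swapOn_of_notMem hxC]
    have hdu1 : ¬G.Sees d u 2 := by
      rw [sees_swapOn_of_ne (by omega) (by omega)]; exact h.not_sees_u
    have hde : d e = 1 := (swapOn_eq_iff (by omega) (by omega)).2 hce
    -- After the swap `u` and `x` both see `b` and miss `a`. Recoloring `e` by `a` makes both see
    -- `a` and `b`.
    have hcol := hd.update h.link_e (i := a) (by omega) hdua hdxa
    have hu : ∀ j, j ≠ 0 →
        (G.Sees (Function.update d e a) u j ↔ j = a ∨ G.Sees d u j ∧ j ≠ d e) :=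
      fun j => hd.proper.sees_update h.link_e.inc_left
    have hx : ∀ j, j ≠ 0 →
        (G.Sees (Function.update d e a) x j ↔ j = a ∨ G.Sees d x j ∧ j ≠ d e) :=
      fun j => hd.proper.sees_update h.link_e.inc_right
    have h1 : G.conflictCount (Function.update d e a) 1 2 ≤ G.conflictCount c 1 2 := by
      refine conflictCount_le_of_subsingleton hE h.left
        (not_isConflict_of_not_sees h.link.inc_left ?_ ?_) S hSs fun m hmp hmx hm => hdA ?_
      · rw [hu 1 (by omega)]; omega
      · rw [hu 2 (by omega)]
        rintro (h' | h')
        · omega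
        · exact hdu1 h'.1
      · have hm3 := hd3.1 (eq_three_of_update_eq_three (by omega) hm.1)
        exact hm.of_update h.link_e (by omega) (fun hi => hmp (h.eq_p hm3 (Or.inl hi)))
          fun hi => hmx ⟨hi, hm3⟩
    have h2 : G.conflictCount (Function.update d e a) a b < G.conflictCount c a b := by
      refine conflictCount_lt hE (hB.1 h.right) (not_isConflict_of_sees h.link.inc_left ?_ ?_)
        fun m hmp hm => ?_
      · rw [hu a (by omega)]; exact Or.inl rfl
      · rw [hu b (by omega)]; exact Or.inr ⟨hdub, by omega⟩
      · have hm3 := hd3.1 (eq_three_of_update_eq_three (by omega) hm.1)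
        have hmx : ¬G.Inc m x := by
          intro hmx
          refine not_isConflict_of_sees hmx ?_ ?_ hm
          · rw [hx a (by omega)]; exact Or.inl rfl
          · rw [hx b (by omega)]; exact Or.inr ⟨hdxb, by omega⟩
        exact hdB m hmp (fun h' => hmx h'.1) (hm.of_update h.link_e (by omega)
          (fun hi => hmp (h.eq_p hm3 (Or.inl hi))) hmx)
    have h3 : G.middleCount (Function.update d e a) ≤ G.middleCount c :=
      hdm ▸ middleCount_update_le hE (by omega)
    rw [← hBc, ← hBc] at h2
    have := h.opt.conflict_le _ hcol h3
    omega

theorem sees_x_four_five (hE : G.edgeSet.Finite) (hL : G.Loopless)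
    (h : G.IsDouble c p e u v x) : G.Sees c x 4 ∧ G.Sees c x 5 := by
  have h1 := h.right.seesOne h.link.inc_left
  by_cases h4 : G.Sees c u 4
  · exact ⟨h.sees_x_of_sees_u hE hL (b := 5) (by omega) h4,
      h.sees_x_of_not_sees_u hE hL (a := 4) (by omega) h4⟩
  · have h5 : G.Sees c u 5 := by
      unfold SeesOne at h1
      tauto
    exact ⟨h.sees_x_of_not_sees_u hE hL (a := 5) (by omega) h5,
      h.sees_x_of_sees_u hE hL (b := 4) (by omega) h5⟩

/-- Otherwise recoloring `e` by 2 trades the double conflict `p` for at most one conflict at `x`,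
not double because `x` sees 4 and 5. -/
theorem sees_x_two (hE : G.edgeSet.Finite) (hL : G.Loopless)
    (h : G.IsDouble c p e u v x) : G.Sees c x 2 := by
  classical
  by_contra hx2
  have hc := h.opt.proper
  have hce := h.color_e
  have hcol := h.opt.toIsColoring.update h.link_e (i := 2) (by omega) h.not_sees_u hx2
  have hA : ∀ m ≠ p, m ∉ {m | G.Inc m x ∧ c m = 3} →
      G.IsConflict (Function.update c e 2) 1 2 m → G.IsConflict c 1 2 m := by
    intro m hmp hmx hm
    have hm3 := eq_three_of_update_eq_three (by omega) hm.1
    exact hm.of_update h.link_e (by omega) (fun hi => hmp (h.eq_p hm3 (Or.inl hi)))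
      fun hi => hmx ⟨hi, hm3⟩
  have hB : ∀ m, G.IsConflict (Function.update c e 2) 4 5 m → G.IsConflict c 4 5 m :=
    fun m hm => hm.of_update_of_ne hc (by omega) (by omega) (by omega)
      (by omega) (by omega) (by omega) (by omega)
  have h1 := conflictCount_le_of_subsingleton hE h.left h.not_isConflict_update _
    (hc.subsingleton_middle x) hA
  have h2 := conflictCount_le hE hB
  have h3 : G.doubleCount (Function.update c e 2) < G.doubleCount c := by
    refine doubleCount_lt hE ⟨h.left, h.right⟩ (fun h' => h.not_isConflict_update h'.1)
      fun m hmp hm1 hm2 => ⟨hA m hmp (fun hm => ?_) hm1, hB m hm2⟩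
    obtain ⟨h4, h5⟩ := h.sees_x_four_five hE hL
    exact not_isConflict_of_sees hm.1 h4 h5 (hB m hm2)
  have := h.opt.double_le _ hcol (middleCount_update_le hE (by omega)) (by omega)
  omega

/-- Rotating the colors of `p`, `e` and `q` saves an edge of color `3`. -/
theorem exists_isColoring_middleCount_lt {d : β → ℕ} (hE : G.edgeSet.Finite) (hL : G.Loopless)
    (hd : G.IsColoring 5 d) (hp : G.IsLink p u v) (he : G.IsLink e u x) (hq : G.IsLink q x y)
    (hdp : d p = 3) (hde : d e = 1) (hdq : d q = 3) (hv : ¬G.Sees d v 1) (hy : ¬G.Sees d y 1) :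
    ∃ d', G.IsColoring 5 d' ∧ G.middleCount d' < G.middleCount d := by
  classical
  have hpe : p ≠ e := by rintro rfl; omega
  have hqe : q ≠ e := by rintro rfl; omega
  have hvx : v ≠ x := by rintro rfl; exact hv ⟨e, he.inc_right, hde⟩
  have hyu : y ≠ u := by rintro rfl; exact hy ⟨e, he.inc_left, hde⟩
  have hpx : ¬G.Inc p x := fun h => by
    rcases h.eq_or_eq_of_isLink hp with h | h
    · exact he.ne h.symm
    · exact hvx h.symm
  have hpq : p ≠ q := by rintro rfl; exact hpx hq.inc_left
  have hpy : ¬G.Inc p y := by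
    intro h
    exact hpq (hd.proper h hq.inc_right (by omega) (by omega))
  have s1 : ∀ {w}, ¬G.Sees (Function.update d e 0) w 1 ↔ (G.Inc e w ∨ ¬G.Sees d w 1) := by
    intro w
    by_cases hw : G.Inc e w
    · rw [hd.proper.sees_update hw (by omega), hde]; simp [hw]
    · rw [sees_update_of_not_inc hw]; simp [hw]
  -- Uncoloring `e` frees 1 at `u` and `x`. Giving 1 to `p` and `q` then frees 3 there for `e`.
  have p1 : G.IsPartialColoring (Function.update d e 0) := hd.proper.update (Or.inl rfl)
  have p2 := p1.update_of_not_sees hp (s1.2 (Or.inl he.inc_left)) (s1.2 (Or.inr hv))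
  have p3 := p2.update_of_not_sees (i := 1) hq
    (by rw [sees_update_of_not_inc hpx, s1]; exact Or.inl he.inc_right)
    (by rw [sees_update_of_not_inc hpy, s1]; exact Or.inr hy)
  set d₃ := Function.update (Function.update (Function.update d e 0) p 1) q 1
  have v3 : ∀ f, d₃ f = 3 → d f = 3 ∧ f ≠ p ∧ f ≠ q ∧ f ≠ e := by
    intro f hf
    by_cases h1 : f = q
    · subst h1; simp [d₃] at hf
    by_cases h2 : f = p
    · subst h2; simp [d₃, h1] at hf
    by_cases h3 : f = e
    · subst h3; simp [d₃, h1, h2] at hf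
    simp only [d₃, Function.update_of_ne h1, Function.update_of_ne h2,
      Function.update_of_ne h3] at hf
    exact ⟨hf, h2, h1, h3⟩
  have p4 := p3.update_of_not_sees (i := 3) he
    (by
      rintro ⟨f, hf, hf3⟩
      obtain ⟨h1, h2, -⟩ := v3 f hf3
      exact h2 (hd.proper hf hp.inc_left (by omega) (by omega)))
    (by
      rintro ⟨f, hf, hf3⟩
      obtain ⟨h1, -, h2, -⟩ := v3 f hf3
      exact h2 (hd.proper hf hq.inc_left (by omega) (by omega)))
  refine ⟨_, ⟨p4, fun f hf => ?_⟩, ?_⟩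
  · have := hd.mem f hf
    by_cases h1 : f = e
    · subst h1; simp
    by_cases h2 : f = q
    · subst h2; simp [d₃, h1]
    by_cases h3 : f = p
    · subst h3; simp [d₃, h1, h2]
    simpa only [d₃, Function.update_of_ne h1, Function.update_of_ne h2,
      Function.update_of_ne h3] using this
  · have m1 : G.middleCount (Function.update d e 0) ≤ G.middleCount d :=
      middleCount_update_le hE (by omega)
    have m2 := middleCount_update_lt (c := Function.update d e 0) (i := 1) hE hp.edge_mem
      (by rwa [Function.update_of_ne hpe]) (by omega)
    have m3 : G.middleCount d₃ < _ := middleCount_update_lt (i := 1) hE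
      hq.edge_mem (by rwa [Function.update_of_ne hpq.symm, Function.update_of_ne hqe]) (by omega)
    have m4 := middleCount_update_le_add_one (G := G) (c := d₃) (e := e) (i := 3) hE
    omega

/-- Otherwise swap 1 and 2 on the chain of `y`. It avoids `u` and `v`, and it makes 1 missing at
`y`, so the rotation of `p`, `e`, `q` applies and contradicts the minimality of color 3. -/
theorem sees_y_two (hE : G.edgeSet.Finite) (hL : G.Loopless)
    (h : G.IsDouble c p e u v x) (hq : G.IsLink q x y) (hq3 : c q = 3) :
    G.Sees c y 2 := by
  by_contra hy2
  have hc := h.opt.proper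
  have hx2 := h.sees_x_two hE hL
  have hx1 := h.sees_x
  obtain ⟨-, hyu, hyv⟩ := h.not_inc_of_isLink hL hq hq3
  set Z : Set α := {z | (G.kempeGraph c 1 2 {p}).Reachable y z}
  have hZ : G.IsKempeClosed c 1 2 Z := isKempeClosed_reachable
  have hyZ : y ∈ Z := SimpleGraph.Reachable.refl y
  set d := G.swapOn c 1 2 Z
  have hd : G.IsColoring 5 d := h.opt.toIsColoring.swapOn hZ (by omega) (by omega)
  have hdm : G.middleCount d = G.middleCount c := middleCount_swapOn (by omega) (by omega)
  have hd3 : ∀ {m}, d m = 3 ↔ c m = 3 := swapOn_eq_iff (by omega) (by omega)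
  have huv : ¬(u ∈ Z ∧ v ∈ Z) := by
    rintro ⟨huZ, hvZ⟩
    refine (G.kempeGraph c 1 2 {p}).not_reachable_of_degree_le_one
      (fun w x y z => hc.kempeGraph_degree_le_two (by omega) (by omega)) hyu hyv
      h.link.ne ?_ ?_ ?_ huZ hvZ
    · refine hc.kempeGraph_degree_le_one (by omega) (by omega) (by tauto)
        fun f w hf hf3 _ _ hw => ?_
      obtain rfl : f = q := hc hf.inc_left hq.inc_right (by omega) (by omega)
      obtain rfl := hf.right_unique hq.symm
      exact hw (iff_of_true hx1 hx2)
    · exact hc.kempeGraph_degree_le_one (by omega) (by omega) (fun h' => h.not_sees_u h'.2)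
        fun f w hf hf3 hR => absurd (h.eq_p hf3 (Or.inl hf.inc_left)) hR
    · exact hc.kempeGraph_degree_le_one (by omega) (by omega) (fun h' => h.not_sees_v h'.1)
        fun f w hf hf3 hR => absurd (h.eq_p hf3 (Or.inr hf.inc_left)) hR
  have hA : ∀ m ≠ p, G.IsConflict d 1 2 m → G.IsConflict c 1 2 m :=
    fun m hmp hm => hm.of_swapOn (by omega) (by omega) (R := {p}) hmp
  have hB : ∀ m, G.IsConflict d 4 5 m → G.IsConflict c 4 5 m := fun m hm =>
    hm.of_swapOn_of_ne (by omega) (by omega) (by omega) (by omega) (by omega) (by omega)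
  -- If the chain contained exactly one of `u` and `v`, the swap would resolve `p`.
  have hp : G.IsConflict d 1 2 p := by
    by_contra hp
    have h1 := conflictCount_lt hE h.left hp hA
    have h2 := conflictCount_le hE hB
    have := h.opt.conflict_le d hd hdm.le
    omega
  have huZ : u ∉ Z := by
    intro huZ
    have hvZ : v ∉ Z := fun hvZ => huv ⟨huZ, hvZ⟩
    have h1 : G.Sees d u 2 := (sees_swapOn_of_mem_right huZ).2 h.sees_u
    exact (hp.symm.of_sees h.link h1).2.2 ((hZ.sees_swapOn_of_notMem hvZ).2 h.sees_v)
  have hvZ : v ∉ Z := by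
    intro hvZ
    have h1 : G.Sees d u 1 := (hZ.sees_swapOn_of_notMem huZ).2 h.sees_u
    exact (hp.of_sees h.link h1).2.2 ((sees_swapOn_of_mem_left hvZ).2 h.sees_v)
  obtain ⟨d', hd', hlt⟩ := exists_isColoring_middleCount_lt hE hL hd h.link h.link_e hq
    (hd3.2 h.color_p) ((hZ.swapOn_of_notMem huZ h.link_e.inc_left).trans h.color_e) (hd3.2 hq3)
    (by rw [hZ.sees_swapOn_of_notMem hvZ]; exact h.not_sees_v)
    (by rw [sees_swapOn_of_mem_left hyZ]; exact hy2)
  have := h.opt.middle_le d' hd'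
  omega

end IsDouble

end Graph

/-! ### Splitting five colors and deducing the bounds -/

namespace Graph

variable {α β : Type*} {G : Graph α β} {c : β → ℕ} {F : Set β} {e : β} {v : α} {i k : ℕ}

theorem Sees.of_restrict (h : (G.restrict F).Sees c v i) : G.Sees c v i := by
  obtain ⟨e, he, hi⟩ := h
  exact ⟨e, (restrict_inc.1 he).1, hi⟩

theorem sees_restrict_iff (hF : ∀ e ∈ G.edgeSet, c e = i → e ∈ F) :
    (G.restrict F).Sees c v i ↔ G.Sees c v i := by
  refine ⟨Sees.of_restrict, ?_⟩
  rintro ⟨e, he, hi⟩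
  exact ⟨e, restrict_inc.2 ⟨he, hF e he.edge_mem hi⟩, hi⟩

/-- The edges of a graph with a proper `5`-edge coloring split into two interval colorable
subgraphs. -/
theorem exists_restrict_intervalColorable (hE : G.edgeSet.Finite) (hL : G.Loopless)
    (hc₀ : ∃ c, G.IsColoring 5 c) :
    ∃ F : Set β, (G.restrict F).IntervalColorable ∧ (G.restrict Fᶜ).IntervalColorable := by
  obtain ⟨c₀, hc₀⟩ := hc₀
  obtain ⟨c, hopt⟩ := exists_isOptimal hc₀
  have hc := hopt.proper
  -- the edges of color `1` at the ends of edges in double conflict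
  let E₁ : Set β := {e | ∃ p u v x, G.IsDouble c p e u v x}
  let F : Set β := {e | c e = 4 ∨ c e = 5 ∨ e ∈ E₁ ∨
    (G.IsConflict c 1 2 e ∧ ¬G.IsConflict c 4 5 e)}
  let d : β → ℕ := fun e => if c e = 4 then 1 else if c e = 5 then 2 else 3
  have hE₁ : ∀ e ∈ E₁, c e = 1 := fun e ⟨_, _, _, _, h⟩ => h.color_e
  have hd : ∀ e, (c e = 4 ∧ d e = 1) ∨ (c e = 5 ∧ d e = 2) ∨
      (c e ≠ 4 ∧ c e ≠ 5 ∧ d e = 3) := by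
    intro e
    by_cases h4 : c e = 4
    · simp [d, h4]
    · by_cases h5 : c e = 5 <;> simp [d, h4, h5]
  refine ⟨F, ?_, ?_⟩
  · have hFE : ∀ {e w}, e ∈ E₁ → G.Inc e w → ∀ m, G.IsConflict c 1 2 m → G.Inc m w →
        G.IsConflict c 4 5 m := by
      rintro e w ⟨p, u, v, x, h⟩ hew m hm hmw
      rcases hew.eq_or_eq_of_isLink h.link_e with rfl | rfl
      · rw [h.eq_p hm.1 (Or.inl hmw)]
        exact h.right
      · exact absurd hm (not_isConflict_of_sees hmw h.sees_x (h.sees_x_two hE hL))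
    refine intervalColorable_of_no_conflict (c := d) (fun e f w he hf hef _ => ?_)
      (fun e _ => by have := hd e; omega) fun m hm => ?_
    · rw [restrict_inc] at he hf
      obtain ⟨he, heF⟩ := he
      obtain ⟨hf, hfF⟩ := hf
      have h1 := hd e
      have h2 := hd f
      have key : c e = c f → c e ≠ 0 → e = f := hc he hf
      rcases heF with h | h | h | h <;> rcases hfF with h' | h' | h' | h' <;>
        try exact key (by omega) (by omega)
      all_goals first
        | exact absurd (hFE h he f h'.1 hf) h'.2
        | exact absurd (hFE h' hf e h.1 he) h.2
        | (have := hE₁ e h; have := hE₁ f h'; exact key (by omega) (by omega))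
        | (have := h.1.1; have := h'.1.1; exact key (by omega) (by omega))
    · have hs1 : ∀ w, (G.restrict F).Sees d w 1 ↔ G.Sees c w 4 := by
        intro w
        rw [sees_restrict_iff (F := F) fun e _ he => Or.inl (by have := hd e; omega)]
        exact exists_congr fun e => and_congr_right fun _ => by have := hd e; omega
      have hs2 : ∀ w, (G.restrict F).Sees d w 2 ↔ G.Sees c w 5 := by
        intro w
        rw [sees_restrict_iff (F := F) fun e _ he =>
          Or.inr (Or.inl (by have := hd e; omega))]
        exact exists_congr fun e => and_congr_right fun _ => by have := hd e; omega
      obtain ⟨hm3, u, v, hl, h1, h2, h3, h4⟩ := hm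
      rw [hs1] at h1 h4
      rw [hs2] at h2 h3
      have h5 := hd m
      rcases hl.1 with h | h | ⟨p, u', v', x', h⟩ | h
      · omega
      · omega
      · obtain ⟨hx4, hx5⟩ := h.sees_x_four_five hE hL
        rcases h.link_e.inc_right.eq_or_eq_of_isLink hl.2 with rfl | rfl
        · exact h2 hx5
        · exact h4 hx4
      · exact h.2 ⟨h.1.1, u, v, hl.2, h1, h2, h3, h4⟩
  · have hFc : ∀ e ∈ Fᶜ, c e ≠ 4 ∧ c e ≠ 5 ∧ e ∉ E₁ ∧
        (G.IsConflict c 1 2 e → G.IsConflict c 4 5 e) := by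
      intro e he
      refine ⟨fun h => he (Or.inl h), fun h => he (Or.inr (Or.inl h)),
        fun h => he (Or.inr (Or.inr (Or.inl h))), fun h => ?_⟩
      by_contra h'
      exact he (Or.inr (Or.inr (Or.inr ⟨h, h'⟩)))
    refine intervalColorable_of_no_conflict (c := c) (fun e f w he hf => ?_)
      (fun e he => ?_) fun m hm => ?_
    · exact hc (restrict_inc.1 he).1 (restrict_inc.1 hf).1
    · have h1 := hopt.mem e he.1
      obtain ⟨h4, h5, -⟩ := hFc e he.2
      omega
    · obtain ⟨hm3, u, v, hl, h1, h2, h3, h4⟩ := hm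
      have hs2 : ∀ w, (G.restrict Fᶜ).Sees c w 2 ↔ G.Sees c w 2 := by
        refine fun w => sees_restrict_iff fun e _ he => ?_
        rintro (h | h | h | h)
        · omega
        · omega
        · have := hE₁ e h; omega
        · have := h.1.1; omega
      rw [hs2] at h2 h3
      obtain ⟨-, -, -, hmF⟩ := hFc m hl.1
      -- If `v` lost its color 1, it is an end of a moved edge, and the properties of `u'`, `x'` and
      -- `y` exclude the conflict. Otherwise `m` was a double conflict, and the edge of color 1 at
      -- `u` has been moved.
      by_cases hv1 : G.Sees c v 1
      · obtain ⟨f, hfv, hf1⟩ := hv1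
        have hfF : f ∈ F := by
          by_contra hfF
          exact h4 ⟨f, restrict_inc.2 ⟨hfv, hfF⟩, hf1⟩
        have hfE : f ∈ E₁ := by
          rcases hfF with h | h | h | h
          · omega
          · omega
          · exact h
          · have := h.1.1; omega
        obtain ⟨p, u', v', x', h⟩ := hfE
        rcases hfv.eq_or_eq_of_isLink h.link_e with rfl | rfl
        · exact h.not_sees_u h3
        · exact h2 (h.sees_y_two hE hL hl.2.symm hm3)
      · have hconf : G.IsConflict c 1 2 m := ⟨hm3, u, v, hl.2, h1.of_restrict, h2, h3, hv1⟩
        obtain ⟨f, hf, hf1⟩ := h1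
        rw [restrict_inc] at hf
        obtain ⟨x, hfx⟩ := hf.1
        exact (hFc f hf.2).2.2.1 ⟨m, u, v, x, hopt, hconf, hmF hconf, hl.2, hfx, hf1⟩

/-- Grouping the colors of a proper `5k`-edge coloring by fives gives a decomposition into `2k`
interval colorable subgraphs. -/
theorem hasIntervalDecomposition_of_isColoring (hE : G.edgeSet.Finite) (hL : G.Loopless)
    (hc : G.IsColoring (5 * k) c) : G.HasIntervalDecomposition (2 * k) := by
  let K : ℕ → Set β := fun j => {e | 5 * j < c e ∧ c e ≤ 5 * (j + 1)}
  have hK : ∀ j, ∃ F : Set β, ((G.restrict (K j)).restrict F).IntervalColorable ∧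
      ((G.restrict (K j)).restrict Fᶜ).IntervalColorable := by
    intro j
    refine exists_restrict_intervalColorable (hE.subset fun e he => he.1)
      (Loopless.anti (restrict_le (G := G) (E₀ := K j))) ⟨fun e => c e - 5 * j, ?_, ?_⟩
    · intro e f w he hf hef _
      rw [restrict_inc] at he hf
      have h1 := he.2
      have h2 := hf.2
      simp only [K, Set.mem_ofPred_eq] at h1 h2
      have h3 : c e - 5 * j = c f - 5 * j := hef
      exact hc.proper he.1 hf.1 (by omega) (by omega)
    · intro e he
      have h1 := he.2
      simp only [K, Set.mem_ofPred_eq] at h1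
      omega
  choose F hF1 hF2 using hK
  -- The quotient `i / 2` selects the block of five colors, the parity of `i` its half.
  let H : ℕ → Graph α β := fun i =>
    (G.restrict (K (i / 2))).restrict (if i % 2 = 0 then F (i / 2) else (F (i / 2))ᶜ)
  refine ⟨fun i => H i, fun i => restrict_le.trans restrict_le, fun i => ?_, fun e he => ?_⟩
  · by_cases h : (i : ℕ) % 2 = 0
    · simp only [H, h, if_true]; exact hF1 _
    · simp only [H, h, if_false]; exact hF2 _
  · have hck := hc.mem e he
    have hmem : ∀ i, e ∈ (H i).edgeSet ↔ (5 * (i / 2) < c e ∧ c e ≤ 5 * (i / 2 + 1)) ∧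
        (i % 2 = 0 ↔ e ∈ F (i / 2)) := by
      intro i
      by_cases h : i % 2 = 0 <;> simp [H, h, K, he]
    by_cases hF : e ∈ F ((c e - 1) / 5)
    · have hlt : 2 * ((c e - 1) / 5) < 2 * k := by omega
      refine ⟨⟨_, hlt⟩, ?_, fun i hi => ?_⟩
      · have h2 : 2 * ((c e - 1) / 5) / 2 = (c e - 1) / 5 := by omega
        refine (hmem _).2 ⟨?_, ?_⟩
        · rw [h2]; omega
        · simp only [h2, hF, iff_true]; omega
      · obtain ⟨h1, h2⟩ := (hmem i).1 hi
        have h3 : (i : ℕ) / 2 = (c e - 1) / 5 := by omega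
        rw [h3] at h2
        have := h2.2 hF
        exact Fin.ext (by simp only; omega)
    · have hlt : 2 * ((c e - 1) / 5) + 1 < 2 * k := by omega
      refine ⟨⟨_, hlt⟩, ?_, fun i hi => ?_⟩
      · have h2 : (2 * ((c e - 1) / 5) + 1) / 2 = (c e - 1) / 5 := by omega
        refine (hmem _).2 ⟨?_, ?_⟩
        · rw [h2]; omega
        · simp only [h2, hF, iff_false]; omega
      · obtain ⟨h1, h2⟩ := (hmem i).1 hi
        have h3 : (i : ℕ) / 2 = (c e - 1) / 5 := by omega
        rw [h3] at h2
        have h4 : ¬(i : ℕ) % 2 = 0 := fun h => hF (h2.1 h)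
        exact Fin.ext (by simp only; omega)

theorem intervalThickness_le_of_isColoring (hE : G.edgeSet.Finite) (hL : G.Loopless) {n : ℕ}
    (hc : G.IsColoring n c) (hn : n ≤ 5 * k) (hk : 1 ≤ k) :
    G.intervalThickness ≤ ((2 * k : ℕ) : ℕ∞) :=
  iInf₂_le (2 * k) ⟨by omega, hasIntervalDecomposition_of_isColoring hE hL
    ⟨hc.proper, fun e he => ⟨(hc.mem e he).1, (hc.mem e he).2.trans hn⟩⟩⟩

theorem IsProperEdgeColoring.isColoring {t : ℕ} (h : G.IsProperEdgeColoring t c) :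
    G.IsColoring t c :=
  ⟨fun _ _ _ he hf hef _ => by_contra fun hne => h.ne_of_inc he hf hne hef,
    fun e he => h.mem_Icc e he⟩

theorem exists_isColoring_of_chromaticIndex_eq {n : ℕ} (h : G.chromaticIndex = (n : ℕ∞)) :
    ∃ c, G.IsColoring n c := by
  by_contra hno
  -- A coloring with fewer colors is also one with `n` colors.
  have h1 : ((n + 1 : ℕ) : ℕ∞) ≤ G.chromaticIndex := by
    refine le_iInf₂ fun t ⟨c, hc⟩ => ?_
    by_contra hlt
    rw [not_le, Nat.cast_lt] at hlt
    exact hno ⟨c, hc.isColoring.proper, fun e he =>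
      ⟨(hc.isColoring.mem e he).1, (hc.isColoring.mem e he).2.trans (by omega)⟩⟩
  rw [h, Nat.cast_le] at h1
  omega

theorem degree_le_maxDegree (hV : G.vertexSet.Finite) (hv : v ∈ G.vertexSet) :
    G.degree v ≤ G.maxDegree :=
  le_csSup (hV.image _).bddAbove ⟨v, hv, rfl⟩

theorem maxDegree_pos (hV : G.vertexSet.Finite) (hE : G.edgeSet.Finite)
    (h : G.edgeSet.Nonempty) : 1 ≤ G.maxDegree := by
  obtain ⟨e, he⟩ := h
  obtain ⟨u, v, hl⟩ := G.exists_isLink_of_mem_edgeSet he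
  refine le_trans ?_ (degree_le_maxDegree hV hl.left_mem)
  exact (Set.ncard_pos (hE.subset (G.incidenceSet_subset_edgeSet u))).2 ⟨e, hl.inc_left⟩

end Graph

theorem mainTheorem4 {α β : Type*} (G : Graph α β) (hV : G.vertexSet.Finite)
    (hE : G.edgeSet.Finite) (hL : G.Loopless) :
    (G.edgeSet.Nonempty →
      G.intervalThickness ≤ ((2 * ⌈3 * (G.maxDegree : ℚ) / 10⌉₊ : ℕ) : ℕ∞)) ∧
    (G.edgeSet.Nonempty → G.Simple → G.IsClassOne →
      G.intervalThickness ≤ ((2 * ⌈(G.maxDegree : ℚ) / 5⌉₊ : ℕ) : ℕ∞)) ∧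
    (G.Simple → G.IsClassTwo →
      G.intervalThickness ≤ ((2 * ⌈((G.maxDegree : ℚ) + 1) / 5⌉₊ : ℕ) : ℕ∞)) := by
  refine ⟨fun hne => ?_, fun hne _ h => ?_, fun _ h => ?_⟩
  · have hΔ := Graph.maxDegree_pos hV hE hne
    obtain ⟨c, hc, hck⟩ := G.exists_coloring_of_degree_le (k := 3 * G.maxDegree / 2) hE hL
      (fun v hv => Graph.degree_le_maxDegree hV hv) (by omega)
    have h1 := Nat.le_ceil (3 * (G.maxDegree : ℚ) / 10)
    rw [div_le_iff₀ (by norm_num)] at h1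
    have h2 : 3 * G.maxDegree ≤ ⌈3 * (G.maxDegree : ℚ) / 10⌉₊ * 10 := by exact_mod_cast h1
    exact Graph.intervalThickness_le_of_isColoring hE hL ⟨hc, hck⟩ (by omega) (by omega)
  · have hΔ := Graph.maxDegree_pos hV hE hne
    obtain ⟨c, hc⟩ := Graph.exists_isColoring_of_chromaticIndex_eq h
    have h1 := Nat.le_ceil ((G.maxDegree : ℚ) / 5)
    rw [div_le_iff₀ (by norm_num)] at h1
    have h2 : G.maxDegree ≤ ⌈(G.maxDegree : ℚ) / 5⌉₊ * 5 := by exact_mod_cast h1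
    exact Graph.intervalThickness_le_of_isColoring hE hL hc (by omega) (by omega)
  · obtain ⟨c, hc⟩ := Graph.exists_isColoring_of_chromaticIndex_eq h
    have h1 := Nat.le_ceil (((G.maxDegree : ℚ) + 1) / 5)
    rw [div_le_iff₀ (by norm_num)] at h1
    have h2 : G.maxDegree + 1 ≤ ⌈((G.maxDegree : ℚ) + 1) / 5⌉₊ * 5 := by exact_mod_cast h1
    exact Graph.intervalThickness_le_of_isColoring hE hL hc (by omega) (by omega)
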